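/- Let $\mathcal H_1,\mathcal H_2$ be real separable Hilbert spaces and let $y=S^\dagger x+\epsilon$, where $x$ is a random element of $\mathcal H_1$ with $\mathbb E\|x\|^2\le 1$, $S^\dagger:\mathcal H_1\to\mathcal H_2$ is a bounded linear operator, and $\epsilon$ is a random element of $\mathcal H_2$, independent of $x$, with $\mathbb E[\epsilon]=0$ and $\mathbb E\|\epsilon\|^2<\infty$. Let $L_C=\mathbb E[x\otimes x]$ be the covariance operator of $x$, where $(f\otimes e)v=\langle e,v\rangle f$, and let $\mathcal E(S)=\mathbb E\|y-Sx\|^2$ for bounded linear $S:\mathcal H_1\to\mathcal H_2$. Assume: 1. (weak regularity) $S^\dagger=JL_C^r$ for some $r>0$ and some bounded linear operator $J:\mathcal H_1\to\mathcal H_2$; 2. (spectral decay) $\mathrm{Tr}(L_C^s)<\infty$ for some $0<s\le1$; 3. (moment condition) for some $c>0$, every $i\in\{1,2\}$ and every compact linear operator $A:\mathcal H_1\to\mathcal H_i$, $\mathbb E\|Ax\|^4\le c\,(\mathbb E\|Ax\|^2)^2$. Let $0<\eta_*\le\dfrac{e(2r+1-s)}{(1+14c)(2r+2-s)}$. For $T\ge2$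 and i.i.d. copies $z_t=(x_t,y_t)$, $1\le t\le T$, of $(x,y)$, let $S_1=0$ and $$S_{t+1}=S_t-\eta_t(S_tx_t-y_t)\otimes x_t,\qquad \eta_t=\eta_*(T+1)^{-\frac{2r+1-s}{2r+2-s}},\qquad 1\le t\le T.$$ Then there is a constant $C$, independent of $T$, such that for all $T\ge2$ $$\mathbb E_{z_1,\dots,z_T}\big[\mathcal E(S_{T+1})-\mathcal E(S^\dagger)\big]\le C\begin{cases}(T+1)^{-\frac{2r}{2r+1}}\log(T+1),&s=1,\\[2pt](T+1)^{-\frac{2r+1-s}{2r+2-s}},&0<s<1.\end{cases}$$ -/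

import Mathlib

open MeasureTheory ProbabilityTheory

namespace OperatorSGD

noncomputable section

instance instCompleteSpaceEigenspace {H : Type*} [NormedAddCommGroup H] [InnerProductSpace ℝ H]
    [CompleteSpace H] (A : H →L[ℝ] H) (μ : ℝ) :
    CompleteSpace (Module.End.eigenspace (A : Module.End ℝ H) μ) :=
  (ContinuousLinearMap.isClosed_eigenspace (f := A) (μ := μ)).completeSpace_coe

/-- The power `A ^ r`, `r > 0`, of a compact positive self-adjoint operator `A`, defined by its
spectral decomposition: `∑ μ ^ r P_μ`, where `μ` runs over the eigenvalues of `A` and `P_μ` is the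
orthogonal projection onto the eigenspace of `μ`. The series converges in operator norm
(see `summable_opPow`). -/
def opPow {H : Type*} [NormedAddCommGroup H] [InnerProductSpace ℝ H] [CompleteSpace H]
    (A : H →L[ℝ] H) (r : ℝ) : H →L[ℝ] H :=
  ∑' μ : Module.End.Eigenvalues (A : Module.End ℝ H),
    ((μ : ℝ) ^ r) • (Module.End.eigenspace (A : Module.End ℝ H) (μ : ℝ)).starProjection

/-- A positive operator `A` has finite trace: `∑ ⟨A e, e⟩ < ∞` for some (equivalently, any)
orthonormal basis. -/
def FiniteTrace {H : Type*} [NormedAddCommGroup H] [InnerProductSpace ℝ H]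
    (A : H →L[ℝ] H) : Prop :=
  ∃ (ι : Set H) (b : HilbertBasis ι ℝ H), Summable fun i => inner ℝ (A (b i)) (b i)

/-- The covariance operator `L_C = E[x ⊗ x]`, a Bochner integral, where
`(f ⊗ e) v = ⟨e, v⟩ f`. -/
def covOp {Ω H : Type*} [MeasurableSpace Ω] [NormedAddCommGroup H] [InnerProductSpace ℝ H]
    (P : Measure Ω) (x : Ω → H) : H →L[ℝ] H :=
  ∫ ω, InnerProductSpace.rankOne ℝ (x ω) (x ω) ∂P

/-- The population risk `E(S) = E ‖y - S x‖ ^ 2`. -/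
def risk {Ω H₁ H₂ : Type*} [MeasurableSpace Ω] [NormedAddCommGroup H₁] [InnerProductSpace ℝ H₁]
    [NormedAddCommGroup H₂] [InnerProductSpace ℝ H₂]
    (P : Measure Ω) (x : Ω → H₁) (y : Ω → H₂) (S : H₁ →L[ℝ] H₂) : ℝ :=
  ∫ ω, ‖y ω - S (x ω)‖ ^ 2 ∂P

/-- The stochastic gradient descent iterates on the samples `(x_t, y_t)`, `t = 1, 2, …`:
`sgdAfter η x y t` is `S_{t+1}`, the iterate after the first `t` samples, where
`S_1 = 0` and `S_{t+1} = S_t - η_t (S_t x_t - y_t) ⊗ x_t`. -/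
def sgdAfter {H₁ H₂ : Type*} [NormedAddCommGroup H₁] [InnerProductSpace ℝ H₁]
    [NormedAddCommGroup H₂] [InnerProductSpace ℝ H₂]
    (η : ℕ → ℝ) (x : ℕ → H₁) (y : ℕ → H₂) : ℕ → (H₁ →L[ℝ] H₂)
  | 0 => 0
  | t + 1 => sgdAfter η x y t - η (t + 1) •
      InnerProductSpace.rankOne ℝ (sgdAfter η x y t (x (t + 1)) - y (t + 1)) (x (t + 1))

/-- `E ‖A x‖ ^ 4 ≤ c (E ‖A x‖ ^ 2) ^ 2` for all compact linear operators `A : H → K`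
(as an inequality in `[0, ∞]`). -/
def FourthMomentBound {Ω H : Type*} [MeasurableSpace Ω] [NormedAddCommGroup H]
    [InnerProductSpace ℝ H] (K : Type*) [NormedAddCommGroup K] [InnerProductSpace ℝ K]
    (P : Measure Ω) (x : Ω → H) (c : ℝ) : Prop :=
  ∀ A : H →L[ℝ] K, IsCompactOperator A →
    ∫⁻ ω, ‖A (x ω)‖ₑ ^ 4 ∂P ≤ ENNReal.ofReal c * (∫⁻ ω, ‖A (x ω)‖ₑ ^ 2 ∂P) ^ 2

section OpPow

variable {H : Type*} [NormedAddCommGroup H] [InnerProductSpace ℝ H] [CompleteSpace H]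

theorem finite_large_eigenvalues {A : H →L[ℝ] H} (hA : IsCompactOperator A)
    (hS : (A : H →ₗ[ℝ] H).IsSymmetric) {δ : ℝ} (hδ : 0 < δ) :
    {μ : Module.End.Eigenvalues (A : Module.End ℝ H) | δ ≤ |(μ : ℝ)|}.Finite := by
  by_contra hinf
  have hinf : Set.Infinite _ := hinf
  let f := hinf.natEmbedding
  have hex : ∀ n, ∃ v : H, A v = ((f n).1 : ℝ) • v ∧ ‖v‖ = 1 := by
    intro n
    obtain ⟨v, hv⟩ := Module.End.HasEigenvalue.exists_hasEigenvector (f n).1.2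
    have hv0 : ‖v‖ ≠ 0 := norm_ne_zero_iff.2 hv.2
    refine ⟨‖v‖⁻¹ • v, ?_, ?_⟩
    · have := hv.apply_eq_smul
      simp only [ContinuousLinearMap.coe_coe] at this
      rw [map_smul, this, smul_comm]
      rfl
    · rw [norm_smul, norm_inv, norm_norm, inv_mul_cancel₀ hv0]
  choose e he hn using hex
  have horth : ∀ m n, m ≠ n → inner ℝ (A (e m)) (A (e n)) = 0 := by
    intro m n hmn
    have hne : ((f m).1 : ℝ) ≠ ((f n).1 : ℝ) := by
      intro h
      exact hmn (f.injective (Subtype.ext (Subtype.ext h)))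
    have h1 : inner ℝ (e m) (e n) = 0 :=
      hS.orthogonalFamily_eigenspaces hne
        ⟨e m, Module.End.mem_eigenspace_iff.2 (he m)⟩ ⟨e n, Module.End.mem_eigenspace_iff.2 (he n)⟩
    rw [he, he, inner_smul_left, inner_smul_right, h1]
    simp
  have hsep : ∀ m n, m ≠ n → δ ≤ dist (A (e m)) (A (e n)) := by
    intro m n hmn
    have h1 : ‖A (e m) - A (e n)‖ ^ 2 = ‖A (e m)‖ ^ 2 + ‖A (e n)‖ ^ 2 := by
      rw [@norm_sub_sq_real, horth m n hmn]; ring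
    have h2 : δ ≤ ‖A (e m)‖ := by
      rw [he, norm_smul, hn, mul_one]; exact (f m).2
    rw [dist_eq_norm]
    refine le_of_sq_le_sq ?_ (norm_nonneg _)
    nlinarith [sq_nonneg ‖A (e n)‖]
  obtain ⟨K, hK, hKA⟩ := hA.image_closedBall_subset_compact (f := (A : H →ₗ[ℝ] H)) 1
  have hmem : ∀ n, A (e n) ∈ K := fun n =>
    hKA ⟨e n, by simp [hn n], rfl⟩
  obtain ⟨a, -, φ, hφ, hlim⟩ := hK.tendsto_subseq hmem
  obtain ⟨N, hN⟩ := Metric.cauchySeq_iff.1 hlim.cauchySeq δ hδ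
  have h1 := hN N le_rfl (N + 1) (Nat.le_succ N)
  have h2 := hsep (φ N) (φ (N + 1)) (hφ (Nat.lt_succ_self N)).ne
  exact absurd h1 (not_lt.2 h2)

theorem norm_sum_smul_starProjection_le {A : H →L[ℝ] H}
    (hS : (A : H →ₗ[ℝ] H).IsSymmetric) {ε : ℝ} (hε : 0 ≤ ε)
    (G : Finset (Module.End.Eigenvalues (A : Module.End ℝ H)))
    (c : Module.End.Eigenvalues (A : Module.End ℝ H) → ℝ) (hc : ∀ μ ∈ G, |c μ| ≤ ε) :
    ‖∑ μ ∈ G, c μ •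
      (Module.End.eigenspace (A : Module.End ℝ H) (μ : ℝ)).starProjection‖ ≤ ε := by
  have hO := hS.orthogonalFamily_eigenspaces'
  let p (v : H) (μ : Module.End.Eigenvalues (A : Module.End ℝ H)) :
      Module.End.eigenspace (A : Module.End ℝ H) (μ : ℝ) :=
    (Module.End.eigenspace (A : Module.End ℝ H) (μ : ℝ)).orthogonalProjectionOnto v
  have hB : ∀ v : H, ∑ μ ∈ G, ‖p v μ‖ ^ 2 ≤ ‖v‖ ^ 2 := by
    intro v
    have h1 : ‖∑ μ ∈ G, (p v μ : H)‖ ^ 2 = ∑ μ ∈ G, ‖p v μ‖ ^ 2 := hO.norm_sum (p v) G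
    have h2 : inner ℝ (∑ μ ∈ G, (p v μ : H)) v = ∑ μ ∈ G, ‖p v μ‖ ^ 2 := by
      rw [sum_inner]
      refine Finset.sum_congr rfl fun μ _ => ?_
      have h3 := Submodule.starProjection_inner_eq_zero
        (K := Module.End.eigenspace (A : Module.End ℝ H) (μ : ℝ)) v (p v μ : H) (p v μ).2
      rw [inner_sub_left, sub_eq_zero, real_inner_comm] at h3
      rw [h3]
      exact real_inner_self_eq_norm_sq _
    have h4 := real_inner_le_norm (∑ μ ∈ G, (p v μ : H)) v
    rw [h2, ← h1] at h4
    rw [← h1]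
    have h5 := norm_nonneg (∑ μ ∈ G, (p v μ : H))
    have h6 : ‖∑ μ ∈ G, (p v μ : H)‖ ≤ ‖v‖ := by
      by_contra h7
      push Not at h7
      nlinarith [norm_nonneg v]
    gcongr
  refine ContinuousLinearMap.opNorm_le_bound _ hε fun v => ?_
  have h1 : ‖∑ μ ∈ G, ((c μ • p v μ : Module.End.eigenspace (A : Module.End ℝ H) (μ : ℝ)) : H)‖ ^ 2
      = ∑ μ ∈ G, ‖c μ • p v μ‖ ^ 2 := hO.norm_sum (fun μ => c μ • p v μ) G
  have h2 : (∑ μ ∈ G, c μ •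
      (Module.End.eigenspace (A : Module.End ℝ H) (μ : ℝ)).starProjection) v
      = ∑ μ ∈ G, ((c μ • p v μ : Module.End.eigenspace (A : Module.End ℝ H) (μ : ℝ)) : H) := by
    rw [sum_apply]
    rfl
  rw [h2]
  refine le_of_sq_le_sq ?_ (by positivity)
  rw [h1, mul_pow]
  calc ∑ μ ∈ G, ‖c μ • p v μ‖ ^ 2 ≤ ∑ μ ∈ G, ε ^ 2 * ‖p v μ‖ ^ 2 := by
        refine Finset.sum_le_sum fun μ hμ => ?_
        rw [norm_smul, mul_pow]
        have := hc μ hμ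
        rw [Real.norm_eq_abs]
        gcongr
    _ = ε ^ 2 * ∑ μ ∈ G, ‖p v μ‖ ^ 2 := by rw [Finset.mul_sum]
    _ ≤ ε ^ 2 * ‖v‖ ^ 2 := by gcongr; exact hB v

/-- The series defining `opPow A r` converges in operator norm. -/
theorem summable_opPow {A : H →L[ℝ] H} (hA : IsCompactOperator A)
    (hP : A.IsPositive) {r : ℝ} (hr : 0 < r) :
    Summable fun μ : Module.End.Eigenvalues (A : Module.End ℝ H) =>
      ((μ : ℝ) ^ r) • (Module.End.eigenspace (A : Module.End ℝ H) (μ : ℝ)).starProjection := by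
  have hS : (A : H →ₗ[ℝ] H).IsSymmetric := hP.isSymmetric
  rw [summable_iff_vanishing_norm]
  intro ε hε
  have hδ : 0 < (ε / 2) ^ (1 / r) := by positivity
  refine ⟨(finite_large_eigenvalues hA hS hδ).toFinset, fun G hG => ?_⟩
  refine lt_of_le_of_lt (norm_sum_smul_starProjection_le hS (ε := ε / 2) (by positivity) G _
    fun μ hμ => ?_) (by linarith)
  have h1 : |(μ : ℝ)| < (ε / 2) ^ (1 / r) := by
    by_contra h
    exact Finset.disjoint_left.1 hG hμ (by simpa using h)
  calc |(μ : ℝ) ^ r| ≤ |(μ : ℝ)| ^ r := Real.abs_rpow_le_abs_rpow _ _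
    _ ≤ ((ε / 2) ^ (1 / r)) ^ r := by gcongr
    _ = ε / 2 := by rw [← Real.rpow_mul (by positivity), one_div_mul_cancel hr.ne', Real.rpow_one]

/-- `opPow A r` acts on the eigenspace of `μ` as multiplication by `μ ^ r`. -/
theorem opPow_apply_of_eigenvector {A : H →L[ℝ] H} (hA : IsCompactOperator A)
    (hP : A.IsPositive) {r : ℝ} (hr : 0 < r) {μ : ℝ} {v : H} (hv : A v = μ • v) :
    opPow A r v = (μ ^ r) • v := by
  have hS : (A : H →ₗ[ℝ] H).IsSymmetric := hP.isSymmetric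
  by_cases hv0 : v = 0
  · simp [hv0]
  have hmem : v ∈ Module.End.eigenspace (A : Module.End ℝ H) μ := Module.End.mem_eigenspace_iff.2 hv
  let μ' : Module.End.Eigenvalues (A : Module.End ℝ H) :=
    ⟨μ, Module.End.hasEigenvalue_of_hasEigenvector ⟨hmem, hv0⟩⟩
  have h1 := ((summable_opPow hA hP hr).hasSum.mapL (ContinuousLinearMap.apply ℝ H v))
  have h2 := hasSum_single (f := fun ν : Module.End.Eigenvalues (A : Module.End ℝ H) =>
    ContinuousLinearMap.apply ℝ H v (((ν : ℝ) ^ r) •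
      (Module.End.eigenspace (A : Module.End ℝ H) (ν : ℝ)).starProjection)) μ' (by
    intro ν hν
    have hne : (ν : ℝ) ≠ μ := fun h => hν (Subtype.ext h)
    have : (Module.End.eigenspace (A : Module.End ℝ H) (ν : ℝ)).starProjection v = 0 := by
      refine Submodule.eq_starProjection_of_mem_of_inner_eq_zero (Submodule.zero_mem _) ?_
      intro w hw
      rw [sub_zero]
      exact hS.orthogonalFamily_eigenspaces hne.symm ⟨v, hmem⟩ ⟨w, hw⟩
    simp [this])
  have h3 := h1.unique h2
  have h4 : (Module.End.eigenspace (A : Module.End ℝ H) μ).starProjection v = v :=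
    Submodule.starProjection_eq_self_iff.2 hmem
  simp only [ContinuousLinearMap.apply_apply, smul_apply] at h3
  change opPow A r v = (μ ^ r) •
    (Module.End.eigenspace (A : Module.End ℝ H) μ).starProjection v at h3
  rw [h3, h4]

end OpPow

end

end OperatorSGD

/-!
# Convergence of operator-valued stochastic gradient descent

Let `L` be the covariance operator of the input, `f_j` an orthonormal eigenbasis of `L` with
eigenvalues `λ_j`, and `D_t = S_t - S†` the error of the iterates. Since the noise is centred and
independent of the input, the excess risk of `S_t` is `E ‖D_t x‖ ^ 2 = ∑ λ_j ‖D_t f_j‖ ^ 2`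
(`risk_sub_risk`, `lintegral_enorm_sq_eq_tsum`), so it suffices to follow the scalars
`a_j(t) = E ‖D_t f_j‖ ^ 2`. Expanding the square in
`D_{t+1} f_j = D_t f_j - η ⟨x, f_j⟩ (D_t x - ε)`, the cross terms with the noise vanish, the first
order term is `-2 η λ_j ‖D_t f_j‖ ^ 2`, and the Cauchy-Schwarz inequality with the fourth moment
conditions (for `f_j ⊗ f_j` and for the compact operator `D_t`) bounds the second order term
(`lintegral_step_le`, and `lintegral_error_succ_le` after averaging over the samples):

  `a_j(t+1) ≤ (1 - 2 η λ_j) a_j(t) + η ^ 2 λ_j (c E ‖D_t x‖ ^ 2 + σ ^ 2)`.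

As `∑ λ_j ≤ 1` and `η c ≤ 1`, the prediction errors `E ‖D_t x‖ ^ 2` stay below a level `M` that does
not depend on the number of steps, and then `a_j(t)` is at most
`(1 - 2 η λ_j) ^ t ‖S† f_j‖ ^ 2 + η (c M + σ ^ 2) / 2` (`error_recursion`). Summed against `λ_j`, the
second term is of the order of the step size, `(T + 1) ^ (-θ)` with
`θ = (2 r + 1 - s) / (2 r + 2 - s)`. In the first, `‖S† f_j‖ ^ 2 ≤ ‖J‖ ^ 2 λ_j ^ (2 r)` and
`λ ^ (2 r + 1 - s) (1 - 2 η λ) ^ T ≲ (η T) ^ (-(2 r + 1 - s))`, which is again of order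
`(T + 1) ^ (-θ)`, while `∑ λ_j ^ s` is finite (`bias_le`). This gives the rate `(T + 1) ^ (-θ)` for all
`0 < s ≤ 1`; for `s = 1` the logarithm in the statement is a factor of at least `1`.
-/

open MeasureTheory ProbabilityTheory

namespace OperatorSGD

/-! ### Compactness -/

section Compact

variable {H K : Type*} [NormedAddCommGroup H] [InnerProductSpace ℝ H]
  [NormedAddCommGroup K] [InnerProductSpace ℝ K]

theorem isCompactOperator_rankOne (u : K) (v : H) :
    IsCompactOperator (InnerProductSpace.rankOne ℝ u v) := by
  rw [InnerProductSpace.rankOne_def', ContinuousLinearMap.coe_comp]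
  exact (isCompactOperator_of_locallyCompactSpace_rng
    (ContinuousLinearMap.toSpanSingleton ℝ u)).comp_clm _

theorem isCompactOperator_sgdAfter (η : ℕ → ℝ) (x : ℕ → H) (y : ℕ → K) (t : ℕ) :
    IsCompactOperator (sgdAfter η x y t) := by
  induction t with
  | zero => exact isCompactOperator_zero
  | succ t ih => exact ih.sub ((isCompactOperator_rankOne _ _).smul _)

variable [CompleteSpace H]

theorem isCompactOperator_opPow {A : H →L[ℝ] H} (hA : IsCompactOperator A)
    (hP : A.IsPositive) {r : ℝ} (hr : 0 < r) : IsCompactOperator (opPow A r) := by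
  refine isCompactOperator_of_tendsto (summable_opPow hA hP hr).hasSum
    (Filter.Eventually.of_forall fun G => ?_)
  refine Submodule.sum_mem (compactOperator (RingHom.id ℝ) H H) fun μ _ => ?_
  change IsCompactOperator (((μ : ℝ) ^ r) • _)
  rcases eq_or_ne (μ : ℝ) 0 with h0 | h0
  · rw [h0, Real.zero_rpow hr.ne', zero_smul]
    exact isCompactOperator_zero
  -- on the eigenspace of `μ ≠ 0` the projection is `μ⁻¹ A P_μ`
  · have h1 : (Module.End.eigenspace (A : Module.End ℝ H) (μ : ℝ)).starProjection
        = (μ : ℝ)⁻¹ • (A ∘L (Module.End.eigenspace (A : Module.End ℝ H) (μ : ℝ)).starProjection) := by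
      ext v
      have h2 := Module.End.mem_eigenspace_iff.1 (Submodule.starProjection_apply_mem
        (Module.End.eigenspace (A : Module.End ℝ H) (μ : ℝ)) v)
      simp only [ContinuousLinearMap.coe_coe] at h2
      simp [h2, smul_smul, h0]
    rw [h1]
    exact ((hA.comp_clm _).smul _).smul _

end Compact

/-! ### Eigenbases and traces -/

section Basis

variable {H : Type*} [NormedAddCommGroup H] [InnerProductSpace ℝ H]

theorem countable_hilbertBasis [TopologicalSpace.SeparableSpace H] {ι : Type*}
    (f : HilbertBasis ι ℝ H) : Countable ι := by
  refine Pairwise.countable_of_isOpen_disjoint (s := fun i => Metric.ball (f i) (1 / 2))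
    (fun i j hij => ?_) (fun _ => Metric.isOpen_ball) (fun i => ⟨f i, by simp⟩)
  refine Metric.ball_disjoint_ball ?_
  have h1 : ‖f i - f j‖ ^ 2 = 2 := by
    rw [@norm_sub_sq_real, f.orthonormal.1 i, f.orthonormal.1 j, f.orthonormal.2 hij]; norm_num
  rw [dist_eq_norm]
  nlinarith [norm_nonneg (f i - f j)]

theorem exists_eigenbasis.{u} {H : Type u} [NormedAddCommGroup H] [InnerProductSpace ℝ H]
    [CompleteSpace H] {A : H →L[ℝ] H} (hA : IsCompactOperator A)
    (hP : A.IsPositive) :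
    ∃ (ι : Type u) (f : HilbertBasis ι ℝ H) (lam : ι → ℝ), ∀ j, A (f j) = lam j • f j := by
  have hS : (A : H →ₗ[ℝ] H).IsSymmetric := hP.isSymmetric
  have hex : ∀ μ : Module.End.Eigenvalues (A : Module.End ℝ H),
      ∃ (w : Set (Module.End.eigenspace (A : Module.End ℝ H) (μ : ℝ)))
        (b : HilbertBasis w ℝ (Module.End.eigenspace (A : Module.End ℝ H) (μ : ℝ))),
        ⇑b = ((↑) : w → _) := fun μ => exists_hilbertBasis ℝ _
  choose w b hb using hex
  have horth : Orthonormal ℝ fun a : Σ μ, w μ => ((b a.1 a.2 : _) : H) :=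
    hS.orthogonalFamily_eigenspaces'.orthonormal_sigma_orthonormal (fun μ => (b μ).orthonormal)
  refine ⟨_, HilbertBasis.mkOfOrthogonalEqBot horth ?_, fun a => (a.1 : ℝ), fun a => ?_⟩
  · rw [Submodule.eq_bot_iff]
    intro v hv
    have h1 : ∀ μ : Module.End.Eigenvalues (A : Module.End ℝ H),
        ∀ u ∈ Module.End.eigenspace (A : Module.End ℝ H) (μ : ℝ), inner ℝ u v = 0 := by
      intro μ u hu
      have h2 := ((b μ).hasSum_repr ⟨u, hu⟩).mapL
        ((innerSL ℝ v) ∘L (Module.End.eigenspace (A : Module.End ℝ H) (μ : ℝ)).subtypeL)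
      have h3 : ∀ i, ((innerSL ℝ v) ∘L
          (Module.End.eigenspace (A : Module.End ℝ H) (μ : ℝ)).subtypeL)
            ((b μ).repr ⟨u, hu⟩ i • b μ i) = 0 := by
        intro i
        have h4 := (Submodule.mem_orthogonal' _ _).1 hv (b μ i : H)
          (Submodule.subset_span ⟨⟨μ, i⟩, rfl⟩)
        simp [h4]
      simp only [h3] at h2
      have h5 := h2.unique hasSum_zero
      rw [real_inner_comm]
      simpa using h5
    have h2 : v ∈ (⨆ μ : ℝ, Module.End.eigenspace (A : Module.End ℝ H) μ)ᗮ := by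
      rw [Submodule.mem_orthogonal]
      intro u hu
      refine Submodule.iSup_induction _ (motive := fun u => inner ℝ u v = 0) hu ?_ (by simp) ?_
      · intro μ u hu
        by_cases hμ : Module.End.HasEigenvalue (A : Module.End ℝ H) μ
        · exact h1 ⟨μ, hμ⟩ u hu
        · rw [Module.End.hasEigenvalue_iff, not_not] at hμ
          rw [hμ, Submodule.mem_bot] at hu
          simp [hu]
      · intro u u' h h'
        rw [inner_add_left, h, h', add_zero]
    rw [ContinuousLinearMap.orthogonalComplement_iSup_eigenspaces_eq_bot hA hS] at h2
    exact h2
  · rw [HilbertBasis.coe_mkOfOrthogonalEqBot]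
    exact Module.End.mem_eigenspace_iff.1 (b a.1 a.2).2

variable {ι : Type*}

theorem eigenvalue_nonneg {A : H →L[ℝ] H} (hP : A.IsPositive) (f : HilbertBasis ι ℝ H)
    {μ : ℝ} {j : ι} (h : A (f j) = μ • f j) : 0 ≤ μ := by
  have h1 := hP.inner_nonneg_left (f j)
  rw [h, inner_smul_left, real_inner_self_eq_norm_sq, f.orthonormal.1 j] at h1
  simpa using h1

/-- The quadratic form of an operator that is diagonal in the basis `f`. -/
theorem ofReal_inner_eq_tsum (f : HilbertBasis ι ℝ H) {B : H →L[ℝ] H} {β : ι → ℝ}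
    (hβ : ∀ j, 0 ≤ β j) (hB : ∀ j, B (f j) = β j • f j) (v : H) :
    ENNReal.ofReal (inner ℝ (B v) v) =
      ∑' j, ENNReal.ofReal (β j) * ‖(inner ℝ (f j) v : ℝ)‖ₑ ^ 2 := by
  have h1 : HasSum (fun j => β j * (inner ℝ (f j) v : ℝ) ^ 2) (inner ℝ (B v) v) := by
    have h2 := (f.hasSum_repr v).mapL (((innerSL ℝ v)) ∘L B)
    rw [real_inner_comm]
    refine h2.congr_fun fun j => ?_
    simp only [ContinuousLinearMap.comp_apply, map_smul, hB, f.repr_apply_apply, smul_eq_mul,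
      innerSL_apply_apply, real_inner_comm (f j) v]
    ring
  rw [← h1.tsum_eq, ENNReal.ofReal_tsum_of_nonneg (fun j => by have := hβ j; positivity)
    h1.summable]
  refine tsum_congr fun j => ?_
  rw [ENNReal.ofReal_mul (hβ j), ← sq_abs, ENNReal.ofReal_pow (abs_nonneg _),
    ← Real.norm_eq_abs, ofReal_norm]

theorem enorm_sq_eq_tsum (f : HilbertBasis ι ℝ H) (v : H) :
    ‖v‖ₑ ^ 2 = ∑' j, ‖(inner ℝ (f j) v : ℝ)‖ₑ ^ 2 := by
  have h := ofReal_inner_eq_tsum f (B := ContinuousLinearMap.id ℝ H) (β := fun _ => 1)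
    (by simp) (by simp) v
  simpa [real_inner_self_eq_norm_sq, ENNReal.ofReal_pow] using h

/-- The trace of an operator that is diagonal in the basis `f`, computed in any other basis. -/
theorem tsum_ofReal_eq_trace {κ : Type*} (f : HilbertBasis ι ℝ H) (b : HilbertBasis κ ℝ H)
    {B : H →L[ℝ] H} {β : ι → ℝ} (hβ : ∀ j, 0 ≤ β j) (hB : ∀ j, B (f j) = β j • f j) :
    ∑' j, ENNReal.ofReal (β j) = ∑' i, ENNReal.ofReal (inner ℝ (B (b i)) (b i)) := by
  simp_rw [ofReal_inner_eq_tsum f hβ hB]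
  rw [ENNReal.tsum_comm]
  refine tsum_congr fun j => ?_
  simp_rw [real_inner_comm (b _) (f j)]
  rw [ENNReal.tsum_mul_left, ← enorm_sq_eq_tsum b, ← ofReal_norm, f.orthonormal.1 j]
  simp

end Basis

/-! ### The covariance operator -/

section Covariance

variable {Ω H K : Type*} [MeasurableSpace Ω] {P : Measure Ω}
  [NormedAddCommGroup H] [InnerProductSpace ℝ H]
  [NormedAddCommGroup K] [InnerProductSpace ℝ K] {x : Ω → H}

theorem _root_.Continuous.rankOne {X : Type*} [TopologicalSpace X] {u : X → K} {v : X → H}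
    (hu : Continuous u) (hv : Continuous v) :
    Continuous fun a => InnerProductSpace.rankOne ℝ (u a) (v a) :=
  ((ContinuousLinearMap.smulRightL ℝ H K).continuous.comp
    ((innerSL ℝ).continuous.comp hv)).clm_apply hu

theorem integrable_rankOne_self (hx : MemLp x 2 P) :
    Integrable (fun ω => InnerProductSpace.rankOne ℝ (x ω) (x ω)) P := by
  refine (hx.integrable_norm_pow (p := 2) (by norm_num)).mono ?_ ?_
  · have hcont : Continuous fun u : H => InnerProductSpace.rankOne ℝ u u :=
      continuous_id.rankOne continuous_id
    exact hcont.comp_aestronglyMeasurable hx.1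
  · refine Filter.Eventually.of_forall fun ω => ?_
    simp [sq]

theorem covOp_apply (hx : MemLp x 2 P) (u : H) :
    covOp P x u = ∫ ω, (inner ℝ (x ω) u : ℝ) • x ω ∂P := by
  rw [covOp, ContinuousLinearMap.integral_apply (integrable_rankOne_self hx)]
  rfl

variable [CompleteSpace H]

theorem inner_covOp (hx : MemLp x 2 P) (u v : H) :
    inner ℝ (covOp P x u) v = ∫ ω, (inner ℝ (x ω) u : ℝ) * inner ℝ (x ω) v ∂P := by
  have h1 : Integrable (fun ω => (inner ℝ (x ω) u : ℝ) • x ω) P :=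
    (integrable_rankOne_self hx).apply_continuousLinearMap u
  rw [covOp_apply hx, real_inner_comm, ← integral_inner h1]
  refine integral_congr_ae (Filter.Eventually.of_forall fun ω => ?_)
  simp only [inner_smul_right, real_inner_comm v]

theorem isPositive_covOp (hx : MemLp x 2 P) : (covOp P x).IsPositive := by
  refine ⟨fun u v => ?_, fun u => ?_⟩
  · simp only [ContinuousLinearMap.coe_coe]
    rw [inner_covOp hx, real_inner_comm, inner_covOp hx]
    simp only [mul_comm]
  · rw [ContinuousLinearMap.reApplyInnerSelf_apply, inner_covOp hx]
    exact integral_nonneg fun ω => mul_self_nonneg _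

theorem isCompactOperator_covOp [IsProbabilityMeasure P] (hx : MemLp x 2 P) :
    IsCompactOperator (covOp P x) := by
  have h := (compactOperator (RingHom.id ℝ) H H).convex.integral_mem (μ := P)
    (f := fun ω => InnerProductSpace.rankOne ℝ (x ω) (x ω))
    isClosed_setOfPred_isCompactOperator
    (Filter.Eventually.of_forall fun ω => isCompactOperator_rankOne _ _)
    (integrable_rankOne_self hx)
  exact h

theorem lintegral_inner_sq (hx : MemLp x 2 P) (u : H) :
    ∫⁻ ω, ‖(inner ℝ u (x ω) : ℝ)‖ₑ ^ 2 ∂P = ENNReal.ofReal (inner ℝ (covOp P x u) u) := by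
  have h1 : MemLp (fun ω => (inner ℝ u (x ω) : ℝ)) 2 P := hx.const_inner u
  rw [inner_covOp hx, ofReal_integral_eq_lintegral_ofReal]
  · refine lintegral_congr fun ω => ?_
    rw [real_inner_comm u, ← sq, ← sq_abs, ENNReal.ofReal_pow (abs_nonneg _), ← Real.norm_eq_abs,
      ofReal_norm]
  · simpa only [real_inner_comm _ u, ← sq] using h1.integrable_sq
  · exact Filter.Eventually.of_forall fun ω => mul_self_nonneg _

/-- `E ‖D x‖ ^ 2 = Tr (D L D*) = ∑ λ_j ‖D f_j‖ ^ 2` in an eigenbasis `f` of the covariance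
operator `L`. -/
theorem lintegral_enorm_sq_eq_tsum [CompleteSpace K] [TopologicalSpace.SeparableSpace K]
    (hx : MemLp x 2 P) {ι : Type*} (f : HilbertBasis ι ℝ H) {lam : ι → ℝ}
    (hf : ∀ j, covOp P x (f j) = lam j • f j) (D : H →L[ℝ] K) :
    ∫⁻ ω, ‖D (x ω)‖ₑ ^ 2 ∂P = ∑' j, ENNReal.ofReal (lam j) * ‖D (f j)‖ₑ ^ 2 := by
  have hlam : ∀ j, 0 ≤ lam j := fun j => eigenvalue_nonneg (isPositive_covOp hx) f (hf j)
  -- expand `‖D x‖ ^ 2` in a basis `g` of `K`: `E ⟨g_k, D x⟩ ^ 2 = ⟨L D* g_k, D* g_k⟩`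
  obtain ⟨w, g, -⟩ := exists_hilbertBasis ℝ K
  have := countable_hilbertBasis g
  have h1 : ∀ (u : H) k, (inner ℝ (g k) (D u) : ℝ) = inner ℝ (D.adjoint (g k)) u := fun u k =>
    (ContinuousLinearMap.adjoint_inner_left D u (g k)).symm
  simp_rw [enorm_sq_eq_tsum g (D _), h1]
  rw [lintegral_tsum fun k => ((hx.const_inner (D.adjoint (g k))).1.enorm.pow_const 2)]
  simp_rw [lintegral_inner_sq hx, ofReal_inner_eq_tsum f hlam hf, ← ENNReal.tsum_mul_left]
  rw [ENNReal.tsum_comm]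
  simp only [real_inner_comm]

end Covariance

/-! ### One step of stochastic gradient descent -/

section Moments

theorem integrable_norm_sq {Ω E : Type*} [MeasurableSpace Ω] {P : Measure Ω}
    [NormedAddCommGroup E] {x : Ω → E} (hx : MemLp x 2 P) : Integrable (fun ω => ‖x ω‖ ^ 2) P :=
  hx.integrable_norm_pow (p := 2) (by norm_num)

theorem lintegral_enorm_sq {Ω E : Type*} [MeasurableSpace Ω] {P : Measure Ω}
    [NormedAddCommGroup E] {x : Ω → E} (hx : MemLp x 2 P) :
    ∫⁻ ω, ‖x ω‖ₑ ^ 2 ∂P = ENNReal.ofReal (∫ ω, ‖x ω‖ ^ 2 ∂P) := by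
  rw [ofReal_integral_eq_lintegral_ofReal (integrable_norm_sq hx)
    (Filter.Eventually.of_forall fun ω => by positivity)]
  refine lintegral_congr fun ω => ?_
  rw [ENNReal.ofReal_pow (norm_nonneg _), ofReal_norm]

variable {Ω H K : Type*} [MeasurableSpace Ω] {P : Measure Ω}
  [NormedAddCommGroup H] [InnerProductSpace ℝ H]
  [NormedAddCommGroup K] [InnerProductSpace ℝ K] {x : Ω → H}

theorem memLp_clm (hx : MemLp x 2 P) (D : H →L[ℝ] K) : MemLp (fun ω => D (x ω)) 2 P :=
  D.comp_memLp' hx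

variable [CompleteSpace H]

/-- The fourth moment condition for the operator `f ⊗ f`. -/
theorem lintegral_inner_pow_four_le {c : ℝ} (hx : MemLp x 2 P) (hmom : FourthMomentBound H P x c)
    {f : H} (hf : ‖f‖ = 1) :
    ∫⁻ ω, (‖(inner ℝ f (x ω) : ℝ)‖ₑ ^ 2) ^ 2 ∂P ≤
      ENNReal.ofReal c * (ENNReal.ofReal (inner ℝ (covOp P x f) f)) ^ 2 := by
  have h := hmom (InnerProductSpace.rankOne ℝ f f) (isCompactOperator_rankOne f f)
  have h1 : ‖f‖ₑ = 1 := by rw [← ofReal_norm, hf]; simp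
  simp only [InnerProductSpace.rankOne_apply, enorm_smul, h1, mul_one] at h
  rw [lintegral_inner_sq hx] at h
  simpa only [← pow_mul] using h

/-- Nonzero eigenvalues of the covariance operator force `1 ≤ c`, by Jensen's inequality. -/
theorem one_le_of_fourthMomentBound [IsProbabilityMeasure P] {c : ℝ} (hx : MemLp x 2 P)
    (hmom : FourthMomentBound H P x c) {f : H} (hf : ‖f‖ = 1)
    (hpos : 0 < (inner ℝ (covOp P x f) f : ℝ)) : 1 ≤ c := by
  have h1 := lintegral_inner_pow_four_le hx hmom hf
  have hm : AEMeasurable (fun ω => ‖(inner ℝ f (x ω) : ℝ)‖ₑ ^ 2) P :=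
    (hx.const_inner f).1.enorm.pow_const 2
  have h2 := ENNReal.lintegral_mul_le_Lp_mul_Lq P (p := 2) (q := 2)
    Real.HolderConjugate.two_two hm (aemeasurable_const (b := (1 : ENNReal)))
  simp only [Pi.mul_apply, mul_one, ENNReal.one_rpow, lintegral_const, measure_univ] at h2
  rw [lintegral_inner_sq hx] at h2
  have h3 : (ENNReal.ofReal (inner ℝ (covOp P x f) f)) ^ 2 ≤
      ENNReal.ofReal c * (ENNReal.ofReal (inner ℝ (covOp P x f) f)) ^ 2 := by
    refine le_trans ?_ h1
    calc _ ≤ ((∫⁻ ω, (‖(inner ℝ f (x ω) : ℝ)‖ₑ ^ 2) ^ (2 : ℝ) ∂P) ^ (1 / 2 : ℝ)) ^ 2 := by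
          gcongr
      _ = _ := by
          rw [← ENNReal.rpow_natCast, ← ENNReal.rpow_mul]
          simp
  by_contra hc
  push Not at hc
  rw [← ENNReal.ofReal_pow hpos.le] at h3
  rcases le_or_gt c 0 with h0 | h0
  · rw [ENNReal.ofReal_of_nonpos h0, zero_mul, nonpos_iff_eq_zero, ENNReal.ofReal_eq_zero] at h3
    exact absurd h3 (not_le.2 (by positivity))
  · rw [← ENNReal.ofReal_mul h0.le, ENNReal.ofReal_le_ofReal_iff (by positivity)] at h3
    nlinarith [pow_pos hpos 2]

/-- Cauchy-Schwarz with the two fourth moment conditions. -/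
theorem lintegral_mixed_fourth_le {c : ℝ} (hx : MemLp x 2 P)
    (hmom₁ : FourthMomentBound H P x c) (hmom₂ : FourthMomentBound K P x c)
    {f : H} (hf : ‖f‖ = 1) {D : H →L[ℝ] K} (hD : IsCompactOperator D) :
    ∫⁻ ω, ‖(inner ℝ f (x ω) : ℝ)‖ₑ ^ 2 * ‖D (x ω)‖ₑ ^ 2 ∂P ≤
      ENNReal.ofReal c * ENNReal.ofReal (inner ℝ (covOp P x f) f) *
        ∫⁻ ω, ‖D (x ω)‖ₑ ^ 2 ∂P := by
  have h1 := lintegral_inner_pow_four_le hx hmom₁ hf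
  have h2 := hmom₂ D hD
  have hm1 : AEMeasurable (fun ω => ‖(inner ℝ f (x ω) : ℝ)‖ₑ ^ 2) P :=
    (hx.const_inner f).1.enorm.pow_const 2
  have hm2 : AEMeasurable (fun ω => ‖D (x ω)‖ₑ ^ 2) P := (memLp_clm hx D).1.enorm.pow_const 2
  have h3 := ENNReal.lintegral_mul_le_Lp_mul_Lq P (p := 2) (q := 2)
    Real.HolderConjugate.two_two hm1 hm2
  simp only [Pi.mul_apply] at h3
  refine h3.trans ?_
  set C := ENNReal.ofReal c
  set A := ENNReal.ofReal (inner ℝ (covOp P x f) f)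
  set B := ∫⁻ ω, ‖D (x ω)‖ₑ ^ 2 ∂P
  have h2' : ∫⁻ ω, (‖D (x ω)‖ₑ ^ 2) ^ 2 ∂P ≤ C * B ^ 2 := by simpa only [← pow_mul] using h2
  calc _ ≤ (C * A ^ 2) ^ (1 / 2 : ℝ) * (C * B ^ 2) ^ (1 / 2 : ℝ) := by
        simp only [ENNReal.rpow_ofNat]
        gcongr
    _ = ((C * A * B) ^ 2) ^ (1 / 2 : ℝ) := by
        rw [← ENNReal.mul_rpow_of_nonneg _ _ (by norm_num)]
        congr 1
        ring
    _ = C * A * B := by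
        rw [← ENNReal.rpow_natCast, ← ENNReal.rpow_mul]
        simp

end Moments

section Step

variable {Ω H K : Type*} [MeasurableSpace Ω] {P : Measure Ω}
  [NormedAddCommGroup H] [MeasurableSpace H] [BorelSpace H]
  [NormedAddCommGroup K] [InnerProductSpace ℝ K] [CompleteSpace K]
  [MeasurableSpace K] [BorelSpace K] {x : Ω → H} {ε : Ω → K} [IsProbabilityMeasure P]

/-- Independent centred noise is orthogonal to every integrable function of the input. -/
theorem integral_inner_noise (hε : MemLp ε 2 P) (hε0 : ∫ ω, ε ω ∂P = 0)
    (hindep : IndepFun x ε P) {φ : H → K} (hφ : Continuous φ)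
    (hint : Integrable (fun ω => φ (x ω)) P) :
    Integrable (fun ω => (inner ℝ (φ (x ω)) (ε ω) : ℝ)) P ∧
      ∫ ω, (inner ℝ (φ (x ω)) (ε ω) : ℝ) ∂P = 0 := by
  have h1 : IndepFun (fun ω => φ (x ω)) ε P := hindep.comp hφ.measurable measurable_id
  have h2 : Integrable ε P := hε.integrable (by norm_num)
  refine ⟨h1.integrable_bilin hint h2 (innerSL ℝ), ?_⟩
  have h3 := h1.integral_bilin hint h2 (innerSL ℝ)
  rw [hε0, map_zero] at h3
  exact h3

variable [InnerProductSpace ℝ H]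

theorem integral_norm_sub_sq (hx : MemLp x 2 P) (hε : MemLp ε 2 P) (hε0 : ∫ ω, ε ω ∂P = 0)
    (hindep : IndepFun x ε P) (D : H →L[ℝ] K) :
    ∫ ω, ‖D (x ω) - ε ω‖ ^ 2 ∂P = ∫ ω, ‖D (x ω)‖ ^ 2 ∂P + ∫ ω, ‖ε ω‖ ^ 2 ∂P := by
  have h1 := integral_inner_noise hε hε0 hindep D.continuous
    ((memLp_clm hx D).integrable (by norm_num))
  have hD := integrable_norm_sq (memLp_clm hx D)
  have r1 := integral_add (hD.sub (h1.1.const_mul 2)) (integrable_norm_sq hε)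
  have r2 := integral_sub hD (h1.1.const_mul 2)
  simp only [Pi.sub_apply] at r1 r2
  simp_rw [@norm_sub_sq_real]
  rw [r1, r2, integral_const_mul, h1.2]
  ring

/-- The excess risk of `S` is the prediction error `E ‖(S - S†) x‖ ^ 2`. -/
theorem risk_sub_risk {y : Ω → K} {Sdag : H →L[ℝ] K}
    (hx : MemLp x 2 P) (hε : MemLp ε 2 P) (hε0 : ∫ ω, ε ω ∂P = 0)
    (hindep : IndepFun x ε P) (hy : ∀ᵐ ω ∂P, y ω = Sdag (x ω) + ε ω) (S : H →L[ℝ] K) :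
    risk P x y S - risk P x y Sdag = (∫⁻ ω, ‖(S - Sdag) (x ω)‖ₑ ^ 2 ∂P).toReal := by
  have h1 : ∀ S : H →L[ℝ] K, risk P x y S =
      ∫ ω, ‖(S - Sdag) (x ω)‖ ^ 2 ∂P + ∫ ω, ‖ε ω‖ ^ 2 ∂P := by
    intro S
    rw [← integral_norm_sub_sq hx hε hε0 hindep, risk]
    refine integral_congr_ae ?_
    filter_upwards [hy] with ω hω
    rw [hω, ← norm_neg]
    congr 2
    simp
    abel
  rw [h1, h1, lintegral_enorm_sq (memLp_clm hx _),
    ENNReal.toReal_ofReal (integral_nonneg fun ω => by positivity)]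
  simp

/-- One step of stochastic gradient descent contracts the error along an eigenvector `f` of the
covariance operator, up to the variance of the stochastic gradient: the fourth moment condition
bounds the latter by the prediction error of the current iterate and the noise level. -/
theorem lintegral_step_le [CompleteSpace H] {c η lam : ℝ} (hc : 0 ≤ c) (hlam : 0 ≤ lam)
    (hx : MemLp x 2 P) (hε : MemLp ε 2 P) (hε0 : ∫ ω, ε ω ∂P = 0) (hindep : IndepFun x ε P)
    (hmom₁ : FourthMomentBound H P x c) (hmom₂ : FourthMomentBound K P x c)
    {f : H} (hf : ‖f‖ = 1) (hfL : covOp P x f = lam • f) (hη : 2 * η * lam ≤ 1)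
    {D : H →L[ℝ] K} (hD : IsCompactOperator D) :
    ∫⁻ ω, ‖(D - η • InnerProductSpace.rankOne ℝ (D (x ω) - ε ω) (x ω)) f‖ₑ ^ 2 ∂P ≤
      ENNReal.ofReal (1 - 2 * η * lam) * ‖D f‖ₑ ^ 2 +
        ENNReal.ofReal (η ^ 2 * lam) *
          (ENNReal.ofReal c * ∫⁻ ω, ‖D (x ω)‖ₑ ^ 2 ∂P + ∫⁻ ω, ‖ε ω‖ₑ ^ 2 ∂P) := by
  have hLf : (inner ℝ (covOp P x f) f : ℝ) = lam := by
    rw [hfL, inner_smul_left, real_inner_self_eq_norm_sq, hf]; simp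
  have hDx := memLp_clm hx D
  have hu : MemLp (fun ω => (inner ℝ f (x ω) : ℝ)) 2 P := hx.const_inner f
  have hu2 : ∫ ω, (inner ℝ f (x ω) : ℝ) ^ 2 ∂P = lam := by
    have := inner_covOp hx f f
    rw [hLf] at this
    rw [this]
    refine integral_congr_ae (Filter.Eventually.of_forall fun ω => ?_)
    simp only [real_inner_comm f, sq]
  have hui : Integrable (fun ω => (inner ℝ f (x ω) : ℝ) ^ 2) P := hu.integrable_sq
  -- the term `⟨f, x⟩ ⟨D f, D x⟩`
  have i1 : Integrable (fun ω => (inner ℝ f (x ω) : ℝ) * inner ℝ (D f) (D (x ω))) P :=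
    hu.integrable_mul (hDx.const_inner (D f))
  have e1 : ∫ ω, (inner ℝ f (x ω) : ℝ) * inner ℝ (D f) (D (x ω)) ∂P = lam * ‖D f‖ ^ 2 := by
    have h1 := inner_covOp hx f (D.adjoint (D f))
    rw [hfL, inner_smul_left, ContinuousLinearMap.adjoint_inner_right,
      real_inner_self_eq_norm_sq] at h1
    simp only [conj_trivial] at h1
    rw [h1]
    refine integral_congr_ae (Filter.Eventually.of_forall fun ω => ?_)
    simp only [ContinuousLinearMap.adjoint_inner_right, real_inner_comm f,
      real_inner_comm (D f)]
  -- the term `⟨f, x⟩ ^ 2 ‖D x‖ ^ 2`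
  have l2 : ∫⁻ ω, ENNReal.ofReal ((inner ℝ f (x ω) : ℝ) ^ 2 * ‖D (x ω)‖ ^ 2) ∂P ≤
      ENNReal.ofReal (c * lam * ∫ ω, ‖D (x ω)‖ ^ 2 ∂P) := by
    have h1 := lintegral_mixed_fourth_le hx hmom₁ hmom₂ hf hD
    rw [hLf, lintegral_enorm_sq hDx, ← ENNReal.ofReal_mul hc, ← ENNReal.ofReal_mul (by positivity)]
      at h1
    refine le_trans (le_of_eq (lintegral_congr fun ω => ?_)) h1
    rw [ENNReal.ofReal_mul (by positivity), ENNReal.ofReal_pow (norm_nonneg _), ofReal_norm,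
      ← sq_abs, ENNReal.ofReal_pow (abs_nonneg _), ← Real.norm_eq_abs, ofReal_norm]
  have m2 : AEStronglyMeasurable
      (fun ω => (inner ℝ f (x ω) : ℝ) ^ 2 * ‖D (x ω)‖ ^ 2) P := hui.1.mul (integrable_norm_sq hDx).1
  have n2 : 0 ≤ᵐ[P] (fun ω => (inner ℝ f (x ω) : ℝ) ^ 2 * ‖D (x ω)‖ ^ 2) :=
    Filter.Eventually.of_forall fun ω => by positivity
  have i2 : Integrable (fun ω => (inner ℝ f (x ω) : ℝ) ^ 2 * ‖D (x ω)‖ ^ 2) P := by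
    refine ⟨m2, ?_⟩
    rw [hasFiniteIntegral_iff_ofReal n2]
    exact l2.trans_lt ENNReal.ofReal_lt_top
  have hE0 : 0 ≤ ∫ ω, ‖D (x ω)‖ ^ 2 ∂P := integral_nonneg fun ω => by positivity
  have e2 : ∫ ω, (inner ℝ f (x ω) : ℝ) ^ 2 * ‖D (x ω)‖ ^ 2 ∂P ≤
      c * lam * ∫ ω, ‖D (x ω)‖ ^ 2 ∂P := by
    rw [integral_eq_lintegral_of_nonneg_ae n2 m2]
    exact ENNReal.toReal_le_of_le_ofReal (by positivity) l2
  -- the term `⟨f, x⟩ ^ 2 ‖ε‖ ^ 2`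
  have hind3 : IndepFun (fun ω => (inner ℝ f (x ω) : ℝ) ^ 2) (fun ω => ‖ε ω‖ ^ 2) P :=
    hindep.comp (φ := fun v : H => (inner ℝ f v : ℝ) ^ 2) (ψ := fun v : K => ‖v‖ ^ 2)
      (Continuous.measurable (by fun_prop)) (Continuous.measurable (by fun_prop))
  have i3 : Integrable (fun ω => (inner ℝ f (x ω) : ℝ) ^ 2 * ‖ε ω‖ ^ 2) P :=
    hind3.integrable_mul hui (integrable_norm_sq hε)
  have e3 : ∫ ω, (inner ℝ f (x ω) : ℝ) ^ 2 * ‖ε ω‖ ^ 2 ∂P = lam * ∫ ω, ‖ε ω‖ ^ 2 ∂P := by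
    rw [hind3.integral_fun_mul_eq_mul_integral hui.1 (integrable_norm_sq hε).1, hu2]
  -- the two terms linear in the noise
  have h4 := integral_inner_noise hε hε0 hindep (φ := fun v => (inner ℝ f v : ℝ) • D f)
    (by fun_prop) ((hu.integrable (by norm_num)).smul_const (D f))
  have h5 := integral_inner_noise hε hε0 hindep (φ := fun v => (inner ℝ f v : ℝ) ^ 2 • D v)
    (by fun_prop) (by
      refine (i2.add hui).mono (hui.1.smul hDx.1) (Filter.Eventually.of_forall fun ω => ?_)
      simp only [norm_smul, Pi.add_apply, Real.norm_eq_abs]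
      rw [abs_of_nonneg (sq_nonneg (inner ℝ f (x ω) : ℝ)), abs_of_nonneg (by positivity)]
      nlinarith [mul_nonneg (sq_nonneg (inner ℝ f (x ω) : ℝ)) (sq_nonneg (‖D (x ω)‖ - 1)),
        mul_nonneg (sq_nonneg (inner ℝ f (x ω) : ℝ)) (sq_nonneg ‖D (x ω)‖)])
  simp only [inner_smul_left, conj_trivial] at h4 h5
  have key : ∀ ω, ‖(D - η • InnerProductSpace.rankOne ℝ (D (x ω) - ε ω) (x ω)) f‖ ^ 2 =
      ‖D f‖ ^ 2 - 2 * η * ((inner ℝ f (x ω) : ℝ) * inner ℝ (D f) (D (x ω)))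
        + η ^ 2 * ((inner ℝ f (x ω) : ℝ) ^ 2 * ‖D (x ω)‖ ^ 2)
        + η ^ 2 * ((inner ℝ f (x ω) : ℝ) ^ 2 * ‖ε ω‖ ^ 2)
        + 2 * η * ((inner ℝ f (x ω) : ℝ) * inner ℝ (D f) (ε ω))
        - 2 * η ^ 2 * ((inner ℝ f (x ω) : ℝ) ^ 2 * inner ℝ (D (x ω)) (ε ω)) := by
    intro ω
    simp only [sub_apply, smul_apply, InnerProductSpace.rankOne_apply, smul_smul]
    rw [@norm_sub_sq_real, norm_smul, mul_pow, @norm_sub_sq_real, inner_smul_right, inner_sub_right,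
      Real.norm_eq_abs, sq_abs, real_inner_comm f]
    ring
  have iA := (integrable_const (μ := P) (‖D f‖ ^ 2)).sub (i1.const_mul (2 * η))
  have iB := iA.add (i2.const_mul (η ^ 2))
  have iC := iB.add (i3.const_mul (η ^ 2))
  have iD := iC.add (h4.1.const_mul (2 * η))
  have iE := iD.sub (h5.1.const_mul (2 * η ^ 2))
  have hint : ∫ ω, ‖(D - η • InnerProductSpace.rankOne ℝ (D (x ω) - ε ω) (x ω)) f‖ ^ 2 ∂P ≤
      (1 - 2 * η * lam) * ‖D f‖ ^ 2 +
        η ^ 2 * lam * (c * ∫ ω, ‖D (x ω)‖ ^ 2 ∂P + ∫ ω, ‖ε ω‖ ^ 2 ∂P) := by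
    simp_rw [key]
    have r5 := integral_sub iD (h5.1.const_mul (2 * η ^ 2))
    have r4 := integral_add iC (h4.1.const_mul (2 * η))
    have r3 := integral_add iB (i3.const_mul (η ^ 2))
    have r2 := integral_add iA (i2.const_mul (η ^ 2))
    have r1 := integral_sub (integrable_const (μ := P) (‖D f‖ ^ 2)) (i1.const_mul (2 * η))
    simp only [Pi.add_apply, Pi.sub_apply] at r1 r2 r3 r4 r5
    rw [r5, r4, r3, r2, r1]
    simp only [integral_const_mul, h4.2, h5.2, e1, e3, integral_const, probReal_univ, one_smul]
    nlinarith [mul_le_mul_of_nonneg_left e2 (sq_nonneg η)]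
  have hmeas : Integrable
      (fun ω => ‖(D - η • InnerProductSpace.rankOne ℝ (D (x ω) - ε ω) (x ω)) f‖ ^ 2) P := by
    simp_rw [key]
    exact iE
  have hS0 : 0 ≤ ∫ ω, ‖ε ω‖ ^ 2 ∂P := integral_nonneg fun ω => by positivity
  have hq : 0 ≤ 1 - 2 * η * lam := by linarith
  have hconv := ofReal_integral_eq_lintegral_ofReal hmeas
    (Filter.Eventually.of_forall fun ω => by positivity)
  calc _ = ENNReal.ofReal
        (∫ ω, ‖(D - η • InnerProductSpace.rankOne ℝ (D (x ω) - ε ω) (x ω)) f‖ ^ 2 ∂P) := by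
        rw [hconv]
        refine lintegral_congr fun ω => ?_
        rw [ENNReal.ofReal_pow (norm_nonneg _), ofReal_norm]
    _ ≤ ENNReal.ofReal _ := ENNReal.ofReal_le_ofReal hint
    _ = _ := by
        rw [ENNReal.ofReal_add (by positivity) (by positivity), ENNReal.ofReal_mul hq,
          ENNReal.ofReal_mul (by positivity), ENNReal.ofReal_add (by positivity) hS0,
          ENNReal.ofReal_mul hc, lintegral_enorm_sq hDx, lintegral_enorm_sq hε,
          ENNReal.ofReal_pow (norm_nonneg _), ofReal_norm]

end Step

/-! ### Independent samples -/

section Iterates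

variable {H K Ω' : Type*} [NormedAddCommGroup H] [NormedAddCommGroup K]

/-- The path of the first `t` samples, extended by zero. -/
def pastSamples (X : ℕ → Ω' → H) (Y : ℕ → Ω' → K) (t : ℕ) (ω : Ω') : ℕ → H × K :=
  fun i => if i ∈ Finset.Icc 1 t then (X i ω, Y i ω) else 0

variable [InnerProductSpace ℝ H] [InnerProductSpace ℝ K] {X : ℕ → Ω' → H} {Y : ℕ → Ω' → K}

theorem sgdAfter_congr {η : ℕ → ℝ} {x x' : ℕ → H} {y y' : ℕ → K} {t : ℕ}
    (hx : ∀ i ∈ Finset.Icc 1 t, x i = x' i) (hy : ∀ i ∈ Finset.Icc 1 t, y i = y' i) :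
    sgdAfter η x y t = sgdAfter η x' y' t := by
  induction t with
  | zero => rfl
  | succ t ih =>
    have hsub : Finset.Icc 1 t ⊆ Finset.Icc 1 (t + 1) := Finset.Icc_subset_Icc_right (by omega)
    have hmem : t + 1 ∈ Finset.Icc 1 (t + 1) := by simp
    simp only [sgdAfter]
    rw [ih (fun i hi => hx i (hsub hi)) (fun i hi => hy i (hsub hi)), hx _ hmem, hy _ hmem]

theorem continuous_sgdAfter (η : ℕ → ℝ) (t : ℕ) :
    Continuous fun w : ℕ → H × K => sgdAfter η (fun i => (w i).1) (fun i => (w i).2) t := by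
  induction t with
  | zero => exact continuous_const
  | succ t ih =>
    have h1 : Continuous fun w : ℕ → H × K => (w (t + 1)).1 := by fun_prop
    have h2 : Continuous fun w : ℕ → H × K => (w (t + 1)).2 := by fun_prop
    have h3 := ((ih.clm_apply h1).sub h2).rankOne h1
    simp only [sgdAfter]
    exact ih.fun_sub (h3.fun_const_smul _)

theorem sgdAfter_pastSamples (η : ℕ → ℝ) (t : ℕ) (ω : Ω') :
    sgdAfter η (fun i => X i ω) (fun i => Y i ω) t =
      sgdAfter η (fun i => (pastSamples X Y t ω i).1) (fun i => (pastSamples X Y t ω i).2) t :=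
  sgdAfter_congr (fun i hi => by simp only [pastSamples, if_pos hi])
    (fun i hi => by simp only [pastSamples, if_pos hi])

end Iterates

section Samples

variable {H K Ω Ω' : Type*} [NormedAddCommGroup H] [NormedAddCommGroup K]
  [MeasurableSpace H] [MeasurableSpace K] [MeasurableSpace Ω] [MeasurableSpace Ω']
  {P : Measure Ω} {P' : Measure Ω'} {X : ℕ → Ω' → H} {Y : ℕ → Ω' → K} {x : Ω → H} {y : Ω → K}
  {t T : ℕ}

theorem aemeasurable_pastSamples
    (hZ : ∀ i ∈ Finset.Icc 1 t, AEMeasurable (fun ω => (X i ω, Y i ω)) P') :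
    AEMeasurable (pastSamples X Y t) P' := by
  refine aemeasurable_pi_lambda _ fun i => ?_
  by_cases hi : i ∈ Finset.Icc 1 t
  · simpa only [pastSamples, if_pos hi] using hZ i hi
  · simpa only [pastSamples, if_neg hi] using aemeasurable_const

theorem indepFun_pastSamples (ht : t + 1 ≤ T)
    (hind : iIndepFun (fun (i : Finset.Icc 1 T) ω => (X i ω, Y i ω)) P')
    (hZ : ∀ i ∈ Finset.Icc 1 T, AEMeasurable (fun ω => (X i ω, Y i ω)) P') :
    IndepFun (pastSamples X Y t) (fun ω => (X (t + 1) ω, Y (t + 1) ω)) P' := by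
  have hmem : t + 1 ∈ Finset.Icc 1 T := by simp [ht]
  have hlt : ∀ i, i ∈ Finset.Icc 1 t → i ∈ Finset.Icc 1 T := by
    intro i hi; rw [Finset.mem_Icc] at hi ⊢; omega
  let S : Finset (Finset.Icc 1 T) := Finset.univ.filter fun i => (i : ℕ) ≤ t
  let S' : Finset (Finset.Icc 1 T) := {⟨t + 1, hmem⟩}
  have hS : ∀ i (hi : i ∈ Finset.Icc 1 t), (⟨i, hlt i hi⟩ : Finset.Icc 1 T) ∈ S := by
    intro i hi; simpa [S] using (Finset.mem_Icc.1 hi).2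
  have hdisj : Disjoint S S' := by simp [S, S']
  have h := hind.indepFun_finset₀ S S' hdisj (fun i => hZ i i.2)
  have h1 : Measurable fun (g : S → H × K) (i : ℕ) =>
      if hi : i ∈ Finset.Icc 1 t then g ⟨⟨i, hlt i hi⟩, hS i hi⟩ else 0 := by
    refine measurable_pi_lambda _ fun i => ?_
    by_cases hi : i ∈ Finset.Icc 1 t
    · simp only [dif_pos hi]; exact measurable_pi_apply _
    · simp only [dif_neg hi]; exact measurable_const
  have h2 : Measurable fun (g : S' → H × K) => g ⟨⟨t + 1, hmem⟩, by simp [S']⟩ :=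
    measurable_pi_apply _
  have h3 := h.comp h1 h2
  refine (congrArg₂ (fun a b => IndepFun a b P') ?_ ?_).mp h3
  · ext1 ω
    ext1 i
    by_cases hi : i ∈ Finset.Icc 1 t
    · simp only [Function.comp, pastSamples, dif_pos hi, if_pos hi]
    · simp only [Function.comp, pastSamples, dif_neg hi, if_neg hi]
  · rfl

/-- Conditioning on the first `t` samples: a fresh sample may be replaced by a copy on `Ω`. -/
theorem lintegral_fresh_sample [IsProbabilityMeasure P] [IsProbabilityMeasure P'] (ht : t + 1 ≤ T)
    (hind : iIndepFun (fun (i : Finset.Icc 1 T) ω => (X i ω, Y i ω)) P')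
    (hid : ∀ i ∈ Finset.Icc 1 T,
      IdentDistrib (fun ω => (X i ω, Y i ω)) (fun ω => (x ω, y ω)) P' P)
    {φ : (ℕ → H × K) × (H × K) → ENNReal} (hφ : Measurable φ) :
    ∫⁻ ω, φ (pastSamples X Y t ω, (X (t + 1) ω, Y (t + 1) ω)) ∂P' =
      ∫⁻ ω, ∫⁻ ω', φ (pastSamples X Y t ω, (x ω', y ω')) ∂P ∂P' := by
  have hmem : t + 1 ∈ Finset.Icc 1 T := by simp [ht]
  have hZ : ∀ i ∈ Finset.Icc 1 T, AEMeasurable (fun ω => (X i ω, Y i ω)) P' :=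
    fun i hi => (hid i hi).aemeasurable_fst
  have hW : AEMeasurable (pastSamples X Y t) P' := aemeasurable_pastSamples fun i hi => hZ i (by
    rw [Finset.mem_Icc] at hi ⊢; omega)
  have h1 := (indepFun_iff_map_prod_eq_prod_map_map hW (hZ _ hmem)).1
    (indepFun_pastSamples ht hind hZ)
  rw [(hid _ hmem).map_eq] at h1
  have hxy := (hid _ hmem).aemeasurable_snd
  have : IsProbabilityMeasure (P.map fun ω => (x ω, y ω)) := Measure.isProbabilityMeasure_map hxy
  rw [← lintegral_map' (f := φ) hφ.aemeasurable (hW.prodMk (hZ _ hmem)), h1,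
    lintegral_prod _ hφ.aemeasurable, lintegral_map' hφ.lintegral_prod_right'.aemeasurable hW]
  refine lintegral_congr fun ω => ?_
  exact lintegral_map' (hφ.comp measurable_prodMk_left).aemeasurable hxy

variable [InnerProductSpace ℝ H] [InnerProductSpace ℝ K]
  [SecondCountableTopology H] [BorelSpace H] [SecondCountableTopology K] [BorelSpace K]

theorem aemeasurable_error (η : ℕ → ℝ) (Sdag : H →L[ℝ] K) (v : H)
    (hZ : ∀ i ∈ Finset.Icc 1 t, AEMeasurable (fun ω => (X i ω, Y i ω)) P') :
    AEMeasurable (fun ω =>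
      ‖(sgdAfter η (fun i => X i ω) (fun i => Y i ω) t - Sdag) v‖ₑ ^ 2) P' := by
  simp_rw [sgdAfter_pastSamples]
  have h1 : Continuous fun w : ℕ → H × K =>
      ‖(sgdAfter η (fun i => (w i).1) (fun i => (w i).2) t - Sdag) v‖ₑ ^ 2 :=
    (ENNReal.continuous_pow 2).comp
      (((continuous_sgdAfter η t).sub continuous_const).clm_apply continuous_const).enorm
  exact h1.measurable.comp_aemeasurable (aemeasurable_pastSamples hZ)

variable [CompleteSpace H] [CompleteSpace K]
  {ε : Ω → K} {Sdag : H →L[ℝ] K}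

/-- The expected prediction error after `t` samples, expanded in an eigenbasis of the covariance
operator. -/
theorem lintegral_prediction_error {ι : Type*} (η : ℕ → ℝ) (hx : MemLp x 2 P)
    (f : HilbertBasis ι ℝ H) {lam : ι → ℝ} (hf : ∀ j, covOp P x (f j) = lam j • f j)
    (hZ : ∀ i ∈ Finset.Icc 1 t, AEMeasurable (fun ω => (X i ω, Y i ω)) P') :
    ∫⁻ ω, ∫⁻ ω', ‖(sgdAfter η (fun i => X i ω) (fun i => Y i ω) t - Sdag) (x ω')‖ₑ ^ 2 ∂P ∂P' =
      ∑' j, ENNReal.ofReal (lam j) *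
        ∫⁻ ω, ‖(sgdAfter η (fun i => X i ω) (fun i => Y i ω) t - Sdag) (f j)‖ₑ ^ 2 ∂P' := by
  have := countable_hilbertBasis f
  simp_rw [lintegral_enorm_sq_eq_tsum hx f hf]
  rw [lintegral_tsum fun j => (aemeasurable_error η Sdag (f j) hZ).const_mul _]
  exact tsum_congr fun j => lintegral_const_mul' _ _ ENNReal.ofReal_ne_top

theorem aemeasurable_prediction_error [IsProbabilityMeasure P] (η : ℕ → ℝ) (hx : MemLp x 2 P)
    (hZ : ∀ i ∈ Finset.Icc 1 t, AEMeasurable (fun ω => (X i ω, Y i ω)) P') :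
    AEMeasurable (fun ω => ∫⁻ ω',
      ‖(sgdAfter η (fun i => X i ω) (fun i => Y i ω) t - Sdag) (x ω')‖ₑ ^ 2 ∂P) P' := by
  obtain ⟨ι, f, lam, hf⟩ := exists_eigenbasis (isCompactOperator_covOp hx) (isPositive_covOp hx)
  have := countable_hilbertBasis f
  simp_rw [lintegral_enorm_sq_eq_tsum hx f hf]
  exact AEMeasurable.tsum fun j => (aemeasurable_error η Sdag (f j) hZ).const_mul _

/-- The one-step inequality, averaged over the samples. -/
theorem lintegral_error_succ_le [IsProbabilityMeasure P] [IsProbabilityMeasure P']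
    {c lam : ℝ} {η : ℕ → ℝ} (hc : 0 ≤ c) (hlam : 0 ≤ lam)
    (hx : MemLp x 2 P) (hε : MemLp ε 2 P) (hε0 : ∫ ω, ε ω ∂P = 0) (hindep : IndepFun x ε P)
    (hy : ∀ᵐ ω ∂P, y ω = Sdag (x ω) + ε ω)
    (hmom₁ : FourthMomentBound H P x c) (hmom₂ : FourthMomentBound K P x c)
    (hSdag : IsCompactOperator Sdag)
    {f : H} (hf : ‖f‖ = 1) (hfL : covOp P x f = lam • f) (hη : 2 * η (t + 1) * lam ≤ 1)
    (ht : t + 1 ≤ T)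
    (hind : iIndepFun (fun (i : Finset.Icc 1 T) ω => (X i ω, Y i ω)) P')
    (hid : ∀ i ∈ Finset.Icc 1 T,
      IdentDistrib (fun ω => (X i ω, Y i ω)) (fun ω => (x ω, y ω)) P' P) :
    ∫⁻ ω, ‖(sgdAfter η (fun i => X i ω) (fun i => Y i ω) (t + 1) - Sdag) f‖ₑ ^ 2 ∂P' ≤
      ENNReal.ofReal (1 - 2 * η (t + 1) * lam) *
        ∫⁻ ω, ‖(sgdAfter η (fun i => X i ω) (fun i => Y i ω) t - Sdag) f‖ₑ ^ 2 ∂P' +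
      ENNReal.ofReal (η (t + 1) ^ 2 * lam) * (ENNReal.ofReal c *
        ∫⁻ ω, ∫⁻ ω', ‖(sgdAfter η (fun i => X i ω) (fun i => Y i ω) t - Sdag) (x ω')‖ₑ ^ 2 ∂P ∂P'
          + ∫⁻ ω, ‖ε ω‖ₑ ^ 2 ∂P) := by
  let S : Ω' → H →L[ℝ] K := fun ω => sgdAfter η (fun i => X i ω) (fun i => Y i ω) t
  have hZ : ∀ i ∈ Finset.Icc 1 t, AEMeasurable (fun ω => (X i ω, Y i ω)) P' := fun i hi =>
    (hid i (by rw [Finset.mem_Icc] at hi ⊢; omega)).aemeasurable_fst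
  let φ : (ℕ → H × K) × (H × K) → ENNReal := fun p =>
    ‖(sgdAfter η (fun i => (p.1 i).1) (fun i => (p.1 i).2) t - η (t + 1) •
      InnerProductSpace.rankOne ℝ (sgdAfter η (fun i => (p.1 i).1) (fun i => (p.1 i).2) t p.2.1
        - p.2.2) p.2.1 - Sdag) f‖ₑ ^ 2
  have hφ : Continuous φ := by
    have h0 : Continuous fun p : (ℕ → H × K) × (H × K) =>
        sgdAfter η (fun i => (p.1 i).1) (fun i => (p.1 i).2) t :=
      (continuous_sgdAfter η t).comp continuous_fst
    have h1 : Continuous fun p : (ℕ → H × K) × (H × K) => p.2.1 := by fun_prop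
    have h2 : Continuous fun p : (ℕ → H × K) × (H × K) => p.2.2 := by fun_prop
    have h3 := ((h0.clm_apply h1).fun_sub h2).rankOne h1
    have h4 := ((h0.fun_sub (h3.fun_const_smul (η (t + 1)))).fun_sub
      (continuous_const (y := Sdag))).clm_apply (continuous_const (y := f))
    exact (ENNReal.continuous_pow 2).comp h4.enorm
  have h1 : ∀ ω, ‖(sgdAfter η (fun i => X i ω) (fun i => Y i ω) (t + 1) - Sdag) f‖ₑ ^ 2 =
      φ (pastSamples X Y t ω, (X (t + 1) ω, Y (t + 1) ω)) := by
    intro ω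
    simp only [φ, sgdAfter, ← sgdAfter_pastSamples]
  simp_rw [h1]
  rw [lintegral_fresh_sample ht hind hid hφ.measurable]
  have h2 : ∀ ω, ∫⁻ ω', φ (pastSamples X Y t ω, (x ω', y ω')) ∂P ≤
      ENNReal.ofReal (1 - 2 * η (t + 1) * lam) * ‖(S ω - Sdag) f‖ₑ ^ 2 +
        ENNReal.ofReal (η (t + 1) ^ 2 * lam) * (ENNReal.ofReal c *
          ∫⁻ ω', ‖(S ω - Sdag) (x ω')‖ₑ ^ 2 ∂P + ∫⁻ ω', ‖ε ω'‖ₑ ^ 2 ∂P) := by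
    intro ω
    have hD : IsCompactOperator (S ω - Sdag) := (isCompactOperator_sgdAfter _ _ _ _).sub hSdag
    refine le_trans (le_of_eq ?_)
      (lintegral_step_le hc hlam hx hε hε0 hindep hmom₁ hmom₂ hf hfL hη hD)
    refine lintegral_congr_ae ?_
    filter_upwards [hy] with ω' hω'
    have h3 : S ω (x ω') - y ω' = (S ω - Sdag) (x ω') - ε ω' := by
      rw [hω', sub_apply]; abel
    simp only [φ, ← sgdAfter_pastSamples]
    rw [← h3, sub_right_comm]
  refine (lintegral_mono h2).trans (le_of_eq ?_)
  rw [lintegral_add_left' ((aemeasurable_error η Sdag f hZ).const_mul _),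
    lintegral_const_mul' _ _ ENNReal.ofReal_ne_top, lintegral_const_mul' _ _ ENNReal.ofReal_ne_top,
    lintegral_add_right _ measurable_const, lintegral_const_mul' _ _ ENNReal.ofReal_ne_top,
    lintegral_const, measure_univ, mul_one]

end Samples

/-! ### The error recursion -/

/-- The recursion for the errors `a t j` along the eigenvectors. The variance of the stochastic
gradient feeds back the prediction error `∑ λ_i a t i`; since `η c ≤ 1`, the level
`M = 2 ∑ λ_j b_j + η₀ σ²` of the latter reproduces itself. -/
theorem error_recursion {ι : Type*} {a : ℕ → ι → ENNReal} {lam b : ι → ℝ} {c η η₀ E₁ σ2 : ℝ}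
    {T : ℕ} (hc : 0 ≤ c) (hη : 0 ≤ η) (hηc : η * c ≤ 1) (hη₀ : η ≤ η₀)
    (hE₁ : 0 ≤ E₁) (hσ : 0 ≤ σ2) (hlam : ∀ j, 0 ≤ lam j) (hb : ∀ j, 0 ≤ b j)
    (hq : ∀ j, 2 * η * lam j ≤ 1) (hlam1 : ∑' j, ENNReal.ofReal (lam j) ≤ 1)
    (hbE : ∑' j, ENNReal.ofReal (lam j) * ENNReal.ofReal (b j) ≤ ENNReal.ofReal E₁)
    (h0 : ∀ j, a 0 j ≤ ENNReal.ofReal (b j))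
    (hstep : ∀ t, t + 1 ≤ T → ∀ j, a (t + 1) j ≤
      ENNReal.ofReal (1 - 2 * η * lam j) * a t j + ENNReal.ofReal (η ^ 2 * lam j) *
        (ENNReal.ofReal c * ∑' i, ENNReal.ofReal (lam i) * a t i + ENNReal.ofReal σ2))
    {t : ℕ} (ht : t ≤ T) (j : ι) :
    a t j ≤ ENNReal.ofReal ((1 - 2 * η * lam j) ^ t * b j +
      η * (c * (2 * E₁ + η₀ * σ2) + σ2) / 2) := by
  have hη₀' : 0 ≤ η₀ := hη.trans hη₀
  set M := 2 * E₁ + η₀ * σ2 with hM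
  have hM0 : 0 ≤ M := by positivity
  set G := c * M + σ2 with hG
  have hG0 : 0 ≤ G := by positivity
  induction t generalizing j with
  | zero =>
    refine (h0 j).trans (ENNReal.ofReal_le_ofReal ?_)
    have : 0 ≤ η * G / 2 := by positivity
    simpa using this
  | succ t ih =>
    have hq0 : ∀ j, 0 ≤ 1 - 2 * η * lam j := fun j => by linarith [hq j]
    have hq1 : ∀ j, 1 - 2 * η * lam j ≤ 1 := fun j => by
      have := hlam j
      have : 0 ≤ 2 * η * lam j := by positivity
      linarith
    have he : ∑' i, ENNReal.ofReal (lam i) * a t i ≤ ENNReal.ofReal M := by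
      calc ∑' i, ENNReal.ofReal (lam i) * a t i
          ≤ ∑' i, (ENNReal.ofReal (lam i) * ENNReal.ofReal (b i) +
              ENNReal.ofReal (η * G / 2) * ENNReal.ofReal (lam i)) := by
            refine ENNReal.tsum_le_tsum fun i => ?_
            rw [mul_comm (ENNReal.ofReal (η * G / 2)), ← mul_add,
              ← ENNReal.ofReal_add (hb i) (by positivity)]
            gcongr
            refine (ih (by omega) i).trans (ENNReal.ofReal_le_ofReal ?_)
            gcongr
            exact mul_le_of_le_one_left (hb i) (pow_le_one₀ (hq0 i) (hq1 i))
        _ ≤ ENNReal.ofReal E₁ + ENNReal.ofReal (η * G / 2) * 1 := by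
            rw [ENNReal.tsum_add, ENNReal.tsum_mul_left]
            gcongr
        _ = ENNReal.ofReal (E₁ + η * G / 2) := by
            rw [mul_one, ENNReal.ofReal_add hE₁ (by positivity)]
        _ ≤ ENNReal.ofReal M := by
            refine ENNReal.ofReal_le_ofReal ?_
            nlinarith [mul_le_mul_of_nonneg_right hηc hM0, mul_le_mul_of_nonneg_right hη₀ hσ]
    have hl := hlam j
    have hbj := hb j
    calc a (t + 1) j ≤ _ := hstep t ht j
      _ ≤ ENNReal.ofReal (1 - 2 * η * lam j) *
            ENNReal.ofReal ((1 - 2 * η * lam j) ^ t * b j + η * G / 2) +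
          ENNReal.ofReal (η ^ 2 * lam j) *
            (ENNReal.ofReal c * ENNReal.ofReal M + ENNReal.ofReal σ2) := by
          gcongr
          exact ih (by omega) j
      _ = ENNReal.ofReal ((1 - 2 * η * lam j) ^ (t + 1) * b j + η * G / 2) := by
          have hp : 0 ≤ (1 - 2 * η * lam j) ^ t * b j + η * G / 2 := by
            have := pow_nonneg (hq0 j) t
            positivity
          rw [← ENNReal.ofReal_mul hc, ← ENNReal.ofReal_add (by positivity) hσ,
            ← ENNReal.ofReal_mul (hq0 j), ← ENNReal.ofReal_mul (by positivity),
            ← ENNReal.ofReal_add (mul_nonneg (hq0 j) hp) (by positivity)]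
          congr 1
          rw [← hG]
          ring

/-- `sup_λ λ ^ p (1 - 2 η λ) ^ T ≲ (η T) ^ (-p)`. -/
theorem rpow_mul_one_sub_pow_le {p η lam : ℝ} {T : ℕ} (hp : 0 < p) (hη : 0 < η) (hlam : 0 ≤ lam)
    (hq : 2 * η * lam ≤ 1) (hT : 1 ≤ T) :
    lam ^ p * (1 - 2 * η * lam) ^ T ≤ (p / (η * (T + 1))) ^ p := by
  have hT' : (1 : ℝ) ≤ T := by exact_mod_cast hT
  have h1 : (1 - 2 * η * lam) ^ T ≤ Real.exp (-(η * (T + 1) * lam)) := by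
    calc (1 - 2 * η * lam) ^ T ≤ (Real.exp (-(2 * η * lam))) ^ T := by
          have := Real.add_one_le_exp (-(2 * η * lam))
          refine pow_le_pow_left₀ (by linarith) (by linarith) _
      _ = Real.exp (T * (-(2 * η * lam))) := by rw [← Real.exp_nat_mul]
      _ ≤ _ := by
          refine Real.exp_le_exp.2 ?_
          nlinarith [mul_nonneg (mul_nonneg hη.le hlam) (sub_nonneg.2 hT')]
  -- `z / p ≤ exp (z / p)` at `z = η (T + 1) λ`
  set k := η * ((T : ℝ) + 1) with hk
  have hk0 : 0 < k := by positivity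
  have h2 : lam ≤ p / k * Real.exp (k * lam / p) := by
    have h3 : k * lam / p ≤ Real.exp (k * lam / p) := by
      linarith [Real.add_one_le_exp (k * lam / p)]
    calc lam = p / k * (k * lam / p) := by field_simp
      _ ≤ _ := by gcongr
  calc lam ^ p * (1 - 2 * η * lam) ^ T
      ≤ (p / k * Real.exp (k * lam / p)) ^ p * Real.exp (-(k * lam)) := by
        gcongr
    _ = (p / k) ^ p := by
        rw [Real.mul_rpow (by positivity) (by positivity), ← Real.exp_mul, mul_assoc,
          ← Real.exp_add, div_mul_cancel₀ _ hp.ne', add_neg_cancel, Real.exp_zero, mul_one]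

/-! ### The convergence rate -/

section Rate

variable {Ω H K : Type*} [MeasurableSpace Ω] {P : Measure Ω}
  [NormedAddCommGroup H] [InnerProductSpace ℝ H] [CompleteSpace H]
  [NormedAddCommGroup K] [InnerProductSpace ℝ K] {x : Ω → H}

/-- The two consequences of the step size condition: the feedback factor `η* c` of the variance is
at most `1`, and the step is a contraction along every eigenvector. -/
theorem step_size_bounds {r s c ηstar : ℝ} (hr : 0 < r) (hs1 : s ≤ 1) (hc : 0 < c)
    (hη0 : 0 < ηstar)
    (hη : ηstar ≤ Real.exp 1 * (2 * r + 1 - s) / ((1 + 14 * c) * (2 * r + 2 - s))) :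
    ηstar * c ≤ 1 ∧ (1 ≤ c → 2 * ηstar ≤ 1) := by
  have he := Real.exp_one_lt_d9
  have h1 : ηstar * (1 + 14 * c) ≤ 2.7182818286 := by
    rw [le_div_iff₀ (by nlinarith)] at hη
    have h2 : Real.exp 1 * (2 * r + 1 - s) ≤ 2.7182818286 * (2 * r + 2 - s) := by
      nlinarith [Real.exp_pos 1]
    exact le_of_mul_le_mul_right (by linarith) (show 0 < 2 * r + 2 - s by linarith)
  exact ⟨by nlinarith, fun h => by nlinarith⟩

theorem tsum_ofReal_eigenvalues_le_one [TopologicalSpace.SeparableSpace H] (hx : MemLp x 2 P)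
    (hx1 : ∫ ω, ‖x ω‖ ^ 2 ∂P ≤ 1) {ι : Type*} (f : HilbertBasis ι ℝ H) {lam : ι → ℝ}
    (hf : ∀ j, covOp P x (f j) = lam j • f j) : ∑' j, ENNReal.ofReal (lam j) ≤ 1 := by
  have h := lintegral_enorm_sq_eq_tsum hx f hf (ContinuousLinearMap.id ℝ H)
  simp only [ContinuousLinearMap.id_apply, ← ofReal_norm (f _), f.orthonormal.1] at h
  rw [lintegral_enorm_sq hx] at h
  simp only [ENNReal.ofReal_one, one_pow, mul_one] at h
  rw [← h]
  exact ENNReal.ofReal_le_one.2 hx1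

/-- Spectral decay, expressed in an eigenbasis of the covariance operator. -/
theorem tsum_ofReal_eigenvalues_rpow_ne_top [IsProbabilityMeasure P] (hx : MemLp x 2 P) {s : ℝ} (hs : 0 < s)
    (hspec : FiniteTrace (opPow (covOp P x) s)) {ι : Type*} (f : HilbertBasis ι ℝ H) {lam : ι → ℝ}
    (hf : ∀ j, covOp P x (f j) = lam j • f j) : ∑' j, ENNReal.ofReal (lam j ^ s) ≠ ⊤ := by
  obtain ⟨_, b, hb⟩ := hspec
  have hlam : ∀ j, 0 ≤ lam j := fun j => eigenvalue_nonneg (isPositive_covOp hx) f (hf j)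
  rw [tsum_ofReal_eq_trace f b (fun j => Real.rpow_nonneg (hlam j) s) fun j =>
    opPow_apply_of_eigenvector (isCompactOperator_covOp hx) (isPositive_covOp hx) hs (hf j)]
  exact hb.tsum_ofReal_ne_top

/-- The contribution of the initial error along one eigenvector, after `T` steps. -/
theorem bias_le {r s ηstar j0 lam b : ℝ} (hr : 0 < r) (hs1 : s ≤ 1) (hs : 0 < s)
    (hη0 : 0 < ηstar) (hlam : 0 ≤ lam) {T : ℕ} (hT : 1 ≤ T)
    (hb : b ≤ j0 * lam ^ (2 * r)) (hj0 : 0 ≤ j0)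
    (hq : 2 * (ηstar * ((T : ℝ) + 1) ^ (-((2 * r + 1 - s) / (2 * r + 2 - s)))) * lam ≤ 1) :
    lam * ((1 - 2 * (ηstar * ((T : ℝ) + 1) ^ (-((2 * r + 1 - s) / (2 * r + 2 - s)))) * lam) ^ T
      * b) ≤ j0 * (((2 * r + 1 - s) / ηstar) ^ (2 * r + 1 - s) *
        ((T : ℝ) + 1) ^ (-((2 * r + 1 - s) / (2 * r + 2 - s)))) * lam ^ s := by
  set p := 2 * r + 1 - s with hp
  have hp0 : 0 < p := by rw [hp]; linarith
  have hp1 : 2 * r + 2 - s = p + 1 := by rw [hp]; ring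
  rw [hp1] at hq ⊢
  have hT1 : (0 : ℝ) < (T : ℝ) + 1 := by positivity
  set η := ηstar * ((T : ℝ) + 1) ^ (-(p / (p + 1))) with hη
  have hη' : 0 < η := by positivity
  have hrate : (p / (η * ((T : ℝ) + 1))) ^ p =
      (p / ηstar) ^ p * ((T : ℝ) + 1) ^ (-(p / (p + 1))) := by
    have h1 : η * ((T : ℝ) + 1) = ηstar * ((T : ℝ) + 1) ^ (1 / (p + 1)) := by
      rw [hη, mul_assoc]
      congr 1
      nth_rewrite 2 [← Real.rpow_one ((T : ℝ) + 1)]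
      rw [← Real.rpow_add hT1]
      congr 1
      field_simp
      ring
    rw [h1, ← div_div, Real.div_rpow (by positivity) (by positivity), ← Real.rpow_mul hT1.le,
      Real.rpow_neg hT1.le, div_eq_mul_inv]
    congr 3
    field_simp
  have hsup := rpow_mul_one_sub_pow_le hp0 hη' hlam hq hT
  rw [hrate] at hsup
  have hsplit : lam * lam ^ (2 * r) = lam ^ s * lam ^ p := by
    rw [← Real.rpow_add_of_nonneg hlam hs.le hp0.le]
    nth_rewrite 1 [← Real.rpow_one lam]
    rw [← Real.rpow_add_of_nonneg hlam zero_le_one (by positivity)]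
    congr 1
    rw [hp]; ring
  have hqT : 0 ≤ (1 - 2 * η * lam) ^ T := pow_nonneg (by linarith) _
  have hls : 0 ≤ lam ^ s := Real.rpow_nonneg hlam s
  calc lam * ((1 - 2 * η * lam) ^ T * b)
      ≤ lam * ((1 - 2 * η * lam) ^ T * (j0 * lam ^ (2 * r))) := by gcongr
    _ = j0 * ((lam * lam ^ (2 * r)) * (1 - 2 * η * lam) ^ T) := by ring
    _ = j0 * (lam ^ p * (1 - 2 * η * lam) ^ T) * lam ^ s := by rw [hsplit]; ring
    _ ≤ _ := by gcongr

variable [CompleteSpace K] [MeasurableSpace H] [BorelSpace H] [SecondCountableTopology H]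
  [MeasurableSpace K] [BorelSpace K] [SecondCountableTopology K]
  {y ε : Ω → K} {Sdag : H →L[ℝ] K}

/-- The expected prediction error after `T` samples is of the order of the step size. -/
theorem exists_prediction_error_le [IsProbabilityMeasure P]
    (hx : MemLp x 2 P) (hx1 : ∫ ω, ‖x ω‖ ^ 2 ∂P ≤ 1)
    (hε : MemLp ε 2 P) (hε0 : ∫ ω, ε ω ∂P = 0) (hindep : IndepFun x ε P)
    (hy : ∀ᵐ ω ∂P, y ω = Sdag (x ω) + ε ω)
    {r s c : ℝ} (hr : 0 < r) (hs : 0 < s) (hs1 : s ≤ 1) (hc : 0 < c)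
    (hreg : ∃ J : H →L[ℝ] K, Sdag = J ∘L opPow (covOp P x) r)
    (hspec : FiniteTrace (opPow (covOp P x) s))
    (hmom₁ : FourthMomentBound H P x c) (hmom₂ : FourthMomentBound K P x c)
    {ηstar : ℝ} (hη0 : 0 < ηstar)
    (hη : ηstar ≤ Real.exp 1 * (2 * r + 1 - s) / ((1 + 14 * c) * (2 * r + 2 - s))) :
    ∃ C : ℝ, 0 ≤ C ∧ ∀ T : ℕ, 2 ≤ T →
      ∀ {Ω' : Type*} [MeasurableSpace Ω'] (P' : Measure Ω') [IsProbabilityMeasure P']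
        (X : ℕ → Ω' → H) (Y : ℕ → Ω' → K),
        iIndepFun (fun (t : Finset.Icc 1 T) ω => (X t ω, Y t ω)) P' →
        (∀ t ∈ Finset.Icc 1 T,
          IdentDistrib (fun ω => (X t ω, Y t ω)) (fun ω => (x ω, y ω)) P' P) →
        ∫⁻ ω, ∫⁻ ω', ‖(sgdAfter
          (fun _ => ηstar * ((T : ℝ) + 1) ^ (-((2 * r + 1 - s) / (2 * r + 2 - s))))
          (fun t => X t ω) (fun t => Y t ω) T - Sdag) (x ω')‖ₑ ^ 2 ∂P ∂P' ≤
        ENNReal.ofReal (C * ((T : ℝ) + 1) ^ (-((2 * r + 1 - s) / (2 * r + 2 - s)))) := by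
  obtain ⟨J, hJ⟩ := hreg
  have hL := isCompactOperator_covOp hx
  have hLpos := isPositive_covOp hx
  obtain ⟨ι, f, lam, hf⟩ := exists_eigenbasis hL hLpos
  have hlam : ∀ j, 0 ≤ lam j := fun j => eigenvalue_nonneg hLpos f (hf j)
  have hlam1 := tsum_ofReal_eigenvalues_le_one hx hx1 f hf
  have htr := tsum_ofReal_eigenvalues_rpow_ne_top hx hs hspec f hf
  have hSdag : IsCompactOperator Sdag := by
    rw [hJ]
    exact (isCompactOperator_opPow hL hLpos hr).clm_comp J
  obtain ⟨hηc, hη2⟩ := step_size_bounds hr hs1 hc hη0 hη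
  -- source condition along the eigenvectors
  have hb : ∀ j, ‖Sdag (f j)‖ ^ 2 ≤ ‖J‖ ^ 2 * lam j ^ (2 * r) := by
    intro j
    have h1 : Sdag (f j) = lam j ^ r • J (f j) := by
      rw [hJ, ContinuousLinearMap.comp_apply, opPow_apply_of_eigenvector hL hLpos hr (hf j),
        map_smul]
    have h2 : ‖J (f j)‖ ≤ ‖J‖ := by
      simpa [f.orthonormal.1 j] using J.le_opNorm (f j)
    rw [h1, norm_smul, mul_pow, Real.norm_eq_abs, sq_abs, ← Real.rpow_mul_natCast (hlam j),
      mul_comm]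
    have h3 : r * ((2 : ℕ) : ℝ) = 2 * r := by push_cast; ring
    rw [h3]
    have := Real.rpow_nonneg (hlam j) (2 * r)
    gcongr
  -- a nonzero eigenvalue forces `1 ≤ c`, and then the step size condition gives `2 η* ≤ 1`
  have hlamη : ∀ j, 2 * ηstar * lam j ≤ 1 := by
    intro j
    rcases (hlam j).eq_or_lt with h0 | h0
    · rw [← h0]; simp
    · have h1 : (inner ℝ (covOp P x (f j)) (f j) : ℝ) = lam j := by
        rw [hf, inner_smul_left, real_inner_self_eq_norm_sq, f.orthonormal.1 j]; simp
      have h2 := hη2 (one_le_of_fourthMomentBound hx hmom₁ (f.orthonormal.1 j) (by rwa [h1]))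
      have h3 : lam j ≤ 1 := ENNReal.ofReal_le_one.1 ((ENNReal.le_tsum j).trans hlam1)
      nlinarith
  set E₁ := ∫ ω, ‖Sdag (x ω)‖ ^ 2 ∂P with hE₁
  set σ2 := ∫ ω, ‖ε ω‖ ^ 2 ∂P with hσ2
  have hE₁0 : 0 ≤ E₁ := integral_nonneg fun ω => by positivity
  have hσ0 : 0 ≤ σ2 := integral_nonneg fun ω => by positivity
  have hofReal : ∀ (D : H →L[ℝ] K) v, ‖D v‖ₑ ^ 2 = ENNReal.ofReal (‖D v‖ ^ 2) := fun D v => by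
    rw [ENNReal.ofReal_pow (norm_nonneg _), ofReal_norm]
  have hbE : ∑' j, ENNReal.ofReal (lam j) * ENNReal.ofReal (‖Sdag (f j)‖ ^ 2) ≤
      ENNReal.ofReal E₁ := by
    simp_rw [← hofReal]
    rw [← lintegral_enorm_sq_eq_tsum hx f hf, lintegral_enorm_sq (memLp_clm hx Sdag)]
  set G := c * (2 * E₁ + ηstar * σ2) + σ2 with hG
  have hG0 : 0 ≤ G := by positivity
  set τ := (∑' j, ENNReal.ofReal (lam j ^ s)).toReal with hτ
  have hp0 : 0 < 2 * r + 1 - s := by linarith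
  set κ := ((2 * r + 1 - s) / ηstar) ^ (2 * r + 1 - s) with hκ
  have hκ0 : 0 ≤ κ := by positivity
  refine ⟨‖J‖ ^ 2 * κ * τ + ηstar * G / 2, by positivity, ?_⟩
  intro T hT Ω' _ P' _ X Y hind hid
  set N := ((T : ℝ) + 1) ^ (-((2 * r + 1 - s) / (2 * r + 2 - s))) with hN
  have hN0 : 0 ≤ N := by positivity
  have hN1 : N ≤ 1 := by
    refine Real.rpow_le_one_of_one_le_of_nonpos (by linarith [Nat.cast_nonneg (α := ℝ) T]) ?_
    have : 0 < 2 * r + 2 - s := by linarith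
    rw [neg_nonpos]
    positivity
  have hηle : ηstar * N ≤ ηstar := mul_le_of_le_one_right hη0.le hN1
  have hq : ∀ j, 2 * (ηstar * N) * lam j ≤ 1 := fun j =>
    le_trans (mul_le_mul_of_nonneg_right (by linarith) (hlam j)) (hlamη j)
  have hZ : ∀ i ∈ Finset.Icc 1 T, AEMeasurable (fun ω => (X i ω, Y i ω)) P' :=
    fun i hi => (hid i hi).aemeasurable_fst
  let a : ℕ → ι → ENNReal := fun t j => ∫⁻ ω, ‖(sgdAfter (fun _ => ηstar * N)
    (fun i => X i ω) (fun i => Y i ω) t - Sdag) (f j)‖ₑ ^ 2 ∂P'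
  have hrec : ∀ j, a T j ≤ ENNReal.ofReal ((1 - 2 * (ηstar * N) * lam j) ^ T * ‖Sdag (f j)‖ ^ 2 +
      (ηstar * N) * G / 2) := by
    intro j
    refine error_recursion (a := a) (lam := lam) (b := fun j => ‖Sdag (f j)‖ ^ 2) (T := T) hc.le
      (by positivity) ((mul_le_mul_of_nonneg_right hηle hc.le).trans hηc) hηle hE₁0 hσ0 hlam
      (fun j => by positivity) hq hlam1 hbE (fun j => ?_) (fun t ht j => ?_) le_rfl j
    · simp only [a, sgdAfter, zero_sub, neg_apply, enorm_neg, lintegral_const, measure_univ,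
        mul_one, ← hofReal, le_refl]
    · have h1 := lintegral_error_succ_le (η := fun _ => ηstar * N) hc.le (hlam j) hx hε hε0 hindep
        hy hmom₁ hmom₂ hSdag (f.orthonormal.1 j) (hf j) (hq j) ht hind hid
      rw [lintegral_prediction_error _ hx f hf
        (fun i hi => hZ i (by rw [Finset.mem_Icc] at hi ⊢; omega)), lintegral_enorm_sq hε] at h1
      exact h1
  rw [lintegral_prediction_error _ hx f hf hZ]
  calc ∑' j, ENNReal.ofReal (lam j) * a T j
      ≤ ∑' j, (ENNReal.ofReal (‖J‖ ^ 2 * (κ * N)) * ENNReal.ofReal (lam j ^ s) +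
          ENNReal.ofReal (ηstar * N * G / 2) * ENNReal.ofReal (lam j)) := by
        refine ENNReal.tsum_le_tsum fun j => ?_
        have h1 := bias_le hr hs1 hs hη0 (hlam j) (by omega : 1 ≤ T) (hb j) (sq_nonneg ‖J‖) (hq j)
        have h2 := Real.rpow_nonneg (hlam j) s
        have h3 := hlam j
        calc ENNReal.ofReal (lam j) * a T j ≤ ENNReal.ofReal (lam j) * ENNReal.ofReal
              ((1 - 2 * (ηstar * N) * lam j) ^ T * ‖Sdag (f j)‖ ^ 2 + ηstar * N * G / 2) := by
              gcongr; exact hrec j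
          _ ≤ ENNReal.ofReal (‖J‖ ^ 2 * (κ * N) * lam j ^ s + ηstar * N * G / 2 * lam j) := by
              rw [← ENNReal.ofReal_mul h3]
              refine ENNReal.ofReal_le_ofReal ?_
              rw [mul_add]
              linarith
          _ = _ := by
              rw [ENNReal.ofReal_add (by positivity) (by positivity),
                ENNReal.ofReal_mul (q := lam j ^ s) (by positivity),
                ENNReal.ofReal_mul (q := lam j) (by positivity)]
    _ ≤ ENNReal.ofReal (‖J‖ ^ 2 * (κ * N)) * ENNReal.ofReal τ +
          ENNReal.ofReal (ηstar * N * G / 2) * 1 := by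
        rw [ENNReal.tsum_add, ENNReal.tsum_mul_left, ENNReal.tsum_mul_left, hτ,
          ENNReal.ofReal_toReal htr]
        gcongr
    _ = ENNReal.ofReal ((‖J‖ ^ 2 * κ * τ + ηstar * G / 2) * N) := by
        rw [mul_one, ← ENNReal.ofReal_mul (by positivity),
          ← ENNReal.ofReal_add (by positivity) (by positivity)]
        congr 1
        ring

end Rate

end OperatorSGD

open MeasureTheory ProbabilityTheory OperatorSGD in
theorem mainTheorem2
    {H₁ H₂ : Type*}
    [NormedAddCommGroup H₁] [InnerProductSpace ℝ H₁] [CompleteSpace H₁]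
    [TopologicalSpace.SeparableSpace H₁] [MeasurableSpace H₁] [BorelSpace H₁]
    [NormedAddCommGroup H₂] [InnerProductSpace ℝ H₂] [CompleteSpace H₂]
    [TopologicalSpace.SeparableSpace H₂] [MeasurableSpace H₂] [BorelSpace H₂]
    -- the model `y = S† x + ε`
    {Ω : Type*} [MeasurableSpace Ω] (P : Measure Ω) [IsProbabilityMeasure P]
    (x : Ω → H₁) (ε y : Ω → H₂) (Sdag : H₁ →L[ℝ] H₂)
    (hx : MemLp x 2 P) (hx1 : ∫ ω, ‖x ω‖ ^ 2 ∂P ≤ 1)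
    (hε : MemLp ε 2 P) (hε0 : ∫ ω, ε ω ∂P = 0) (hindep : IndepFun x ε P)
    (hy : ∀ᵐ ω ∂P, y ω = Sdag (x ω) + ε ω)
    -- weak regularity, spectral decay and moment conditions
    (r s c : ℝ) (hr : 0 < r) (hs : 0 < s) (hs1 : s ≤ 1) (hc : 0 < c)
    (hreg : ∃ J : H₁ →L[ℝ] H₂, Sdag = J ∘L opPow (covOp P x) r)
    (hspec : FiniteTrace (opPow (covOp P x) s))
    (hmom₁ : FourthMomentBound H₁ P x c) (hmom₂ : FourthMomentBound H₂ P x c)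
    -- the step size constant
    (ηstar : ℝ) (hη0 : 0 < ηstar)
    (hη : ηstar ≤ Real.exp 1 * (2 * r + 1 - s) / ((1 + 14 * c) * (2 * r + 2 - s))) :
    ∃ C : ℝ, ∀ T : ℕ, 2 ≤ T →
      -- for all i.i.d. samples `(X_t, Y_t)`, `t = 1, …, T`, with the law of `(x, y)`
      ∀ {Ω' : Type*} [MeasurableSpace Ω'] (P' : Measure Ω') [IsProbabilityMeasure P']
        (X : ℕ → Ω' → H₁) (Y : ℕ → Ω' → H₂),
        iIndepFun (fun (t : Finset.Icc 1 T) ω => (X t ω, Y t ω)) P' →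
        (∀ t ∈ Finset.Icc 1 T,
          IdentDistrib (fun ω => (X t ω, Y t ω)) (fun ω => (x ω, y ω)) P' P) →
        let η : ℕ → ℝ := fun _ => ηstar * ((T : ℝ) + 1) ^ (-((2 * r + 1 - s) / (2 * r + 2 - s)))
        let excess : Ω' → ℝ := fun ω =>
          risk P x y (sgdAfter η (fun t => X t ω) (fun t => Y t ω) T) - risk P x y Sdag
        Integrable excess P' ∧
          ∫ ω, excess ω ∂P' ≤ C *
            (if s = 1 then
              ((T : ℝ) + 1) ^ (-(2 * r / (2 * r + 1))) * Real.log ((T : ℝ) + 1)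
            else
              ((T : ℝ) + 1) ^ (-((2 * r + 1 - s) / (2 * r + 2 - s)))) := by
  have : SecondCountableTopology H₁ := UniformSpace.secondCountable_of_separable H₁
  have : SecondCountableTopology H₂ := UniformSpace.secondCountable_of_separable H₂
  obtain ⟨C, hC0, hC⟩ := exists_prediction_error_le hx hx1 hε hε0 hindep hy hr hs hs1 hc hreg hspec
    hmom₁ hmom₂ hη0 hη
  refine ⟨C, fun T hT Ω' _ P' _ X Y hind hid => ?_⟩
  intro η excess
  have hZ : ∀ i ∈ Finset.Icc 1 T, AEMeasurable (fun ω => (X i ω, Y i ω)) P' :=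
    fun i hi => (hid i hi).aemeasurable_fst
  have hbound := hC T hT P' X Y hind hid
  have hmeas := aemeasurable_prediction_error (Sdag := Sdag) η hx hZ
  have hfin := hbound.trans_lt ENNReal.ofReal_lt_top
  have hexcess : excess = fun ω => (∫⁻ ω', ‖(sgdAfter η (fun t => X t ω) (fun t => Y t ω) T
      - Sdag) (x ω')‖ₑ ^ 2 ∂P).toReal := by
    ext1 ω
    exact risk_sub_risk hx hε hε0 hindep hy _
  rw [hexcess]
  refine ⟨integrable_toReal_of_lintegral_ne_top hmeas hfin.ne, ?_⟩
  rw [integral_toReal hmeas (ae_lt_top' hmeas hfin.ne)]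
  have hN : 0 ≤ ((T : ℝ) + 1) ^ (-((2 * r + 1 - s) / (2 * r + 2 - s))) := by positivity
  refine (ENNReal.toReal_le_of_le_ofReal (by positivity) hbound).trans ?_
  refine mul_le_mul_of_nonneg_left ?_ hC0
  split_ifs with h1
  · subst h1
    have h2 : (2 * r + 1 - 1) / (2 * r + 2 - 1) = 2 * r / (2 * r + 1) := by ring_nf
    rw [h2] at hN ⊢
    -- `e ≤ 3 ≤ T + 1`
    have h3 : 1 ≤ Real.log ((T : ℝ) + 1) := by
      rw [Real.le_log_iff_exp_le (by positivity)]
      have h4 : (2 : ℝ) ≤ T := by exact_mod_cast hT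
      linarith [Real.exp_one_lt_d9]
    exact le_mul_of_one_le_right hN h3
  · exact le_rfl
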